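/- For $m\in\mathbb N$ let $\Sigma^{(m)}$ be the Fréchet space of smooth $f:\mathbb R\to\mathbb C$ such that for every $k\ge 0$ there is $C_k$ with $|f^{(k)}(x)|\le C_k(1+|x|)^{m-k}$ for all $x$, and for $\varepsilon>0$ let $\mathcal D_\varepsilon$ be the Fréchet space of smooth $f:\mathbb R\to\mathbb C$ with $p_{k,\varepsilon}(f)^2=\int_{\mathbb R}e^{\varepsilon x^2}|f^{(k)}(x)|^2\,dx<\infty$ for every $k\ge 0$ (with the evident seminorms). For $n\ge 0$, $0\le k\le n$ and $m_0,\dots,m_n\in\mathbb N$ with $m_k\geq 1$, let $$\mathcal F_k(m_0,\dots,m_n)=\Sigma^{(m_0)}\widehat\otimes\cdots\widehat\otimes\Sigma^{(m_{k-1})}\widehat\otimes\mathcal D_{1/m_k}\widehat\otimes\Sigma^{(m_{k+1})}\widehat\otimes\cdots\widehat\otimes\Sigma^{(m_n)}$$ (completed projective tensor product), and let $\mathcal F^{(n)}\subset C^\infty(\mathbb R^{n+1})$ be the sum, over all $k$ and all $m_0,\dots,m_n$, of the images of the spaces $\mathcal F_k(m_0,\dots,m_n)$ under the natural map $a_0\otimes\cdots\otimes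 a_n\mapsto a_0(x_0)\cdots a_n(x_n)$. Let $\alpha(a)(x)=a(-x)$, let $\alpha$ act on functions on $\mathbb R^{n+1}$ by $(\alpha f)(x)=f(-x)$, and define $b_{ev}$ from functions on $\mathbb R^{n+1}$ to functions on $\mathbb R^{n}$ ($n\geq 1$) by $$(b_{ev}f)(x_0,\dots,x_{n-1})=\sum_{i=0}^{n-1}(-1)^i f(x_0,\dots,x_{i-1},x_i,x_i,x_{i+1},\dots,x_{n-1})+(-1)^n f(x_0,\dots,x_{n-1},-x_0),$$ that is, $b_{ev}(a_0\otimes\cdots\otimes a_n)=\sum_{i=0}^{n-1}(-1)^i a_0\otimes\cdots\otimes a_ia_{i+1}\otimes\cdots\otimes a_n+(-1)^n\alpha(a_n)a_0\otimes a_1\otimes\cdots\otimes a_{n-1}$. Then $b_{ev}$ maps $\mathcal F^{(n)}$ to $\mathcal F^{(n-1)}$ for $n\ge1$ and $b_{ev}^2=0$ on $\mathcal F^{(n)}$ for $n\geq 2$, so that $(\mathcal F^{(n)},b_{ev})_{n\ge 0}$ is a complex; $\alpha$ preserves each $\mathcal F^{(n)}$ and commutes with $b_{ev}$. The homology of this complex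 is zero in every degree $n>0$, and in degree $0$ it is one-dimensional over $\mathbb C$ and generated by the class of an even element, i.e. of some $c\in\mathcal F^{(0)}$ with $\alpha(c)=c$. -/

import Mathlib

open scoped ContDiff TensorProduct

namespace EvenHochschild

/-! ### The function spaces on the line -/

theorem natCast_le_smooth (k : ℕ) : (k : WithTop ℕ∞) ≤ ∞ := by
  exact_mod_cast (le_top : (k : ℕ∞) ≤ ⊤)

/-- The space `Σ^(m)` of symbols of order `m` on `ℝ`: smooth functions `f : ℝ → ℂ` with
`|f^(k)(x)| ≤ C_k (1 + |x|)^(m - k)` for every `k`. -/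
def symbolSpace (m : ℕ) : Submodule ℂ (ℝ → ℂ) where
  carrier := {f | ContDiff ℝ ∞ f ∧
    ∀ k : ℕ, ∃ C : ℝ, ∀ x : ℝ, ‖iteratedDeriv k f x‖ ≤ C * (1 + |x|) ^ ((m : ℤ) - (k : ℤ))}
  add_mem' := by
    rintro f g ⟨hf, hf'⟩ ⟨hg, hg'⟩
    refine ⟨hf.add hg, fun k => ?_⟩
    obtain ⟨C, hC⟩ := hf' k
    obtain ⟨D, hD⟩ := hg' k
    refine ⟨C + D, fun x => ?_⟩
    have hk := natCast_le_smooth k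
    rw [iteratedDeriv_add (hf.contDiffAt.of_le hk) (hg.contDiffAt.of_le hk), add_mul]
    exact (norm_add_le _ _).trans (add_le_add (hC x) (hD x))
  zero_mem' := ⟨contDiff_const, fun k => ⟨0, fun x => by simp⟩⟩
  smul_mem' := by
    rintro c f ⟨hf, hf'⟩
    refine ⟨hf.const_smul c, fun k => ?_⟩
    obtain ⟨C, hC⟩ := hf' k
    refine ⟨‖c‖ * C, fun x => ?_⟩
    rw [iteratedDeriv_const_smul (hf.contDiffAt.of_le (natCast_le_smooth k)), norm_smul, mul_assoc]
    exact mul_le_mul_of_nonneg_left (hC x) (norm_nonneg _)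

theorem symbolSpace_bdd {m : ℕ} (k : ℕ) (f : symbolSpace m) :
    BddAbove (Set.range fun x : ℝ =>
      ‖iteratedDeriv k (f : ℝ → ℂ) x‖ * (1 + |x|) ^ ((k : ℤ) - (m : ℤ))) := by
  obtain ⟨C, hC⟩ := f.2.2 k
  refine ⟨C, ?_⟩
  rintro _ ⟨x, rfl⟩
  have hx : (0 : ℝ) < 1 + |x| := by positivity
  refine (mul_le_mul_of_nonneg_right (hC x) (by positivity)).trans (le_of_eq ?_)
  rw [mul_assoc, ← zpow_add₀ hx.ne']
  simp

/-- The seminorm `f ↦ sup_x |f^(k)(x)| (1 + |x|)^(k - m)` of the Fréchet space `Σ^(m)`. -/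
noncomputable def symbolSeminorm (m k : ℕ) : Seminorm ℂ (symbolSpace m) :=
  Seminorm.of
    (fun f => ⨆ x : ℝ, ‖iteratedDeriv k (f : ℝ → ℂ) x‖ * (1 + |x|) ^ ((k : ℤ) - (m : ℤ)))
    (by
      intro f g
      refine ciSup_le fun x => ?_
      have hk := natCast_le_smooth k
      have h1 := le_ciSup (symbolSpace_bdd k f) x
      have h2 := le_ciSup (symbolSpace_bdd k g) x
      refine le_trans ?_ (add_le_add h1 h2)
      simp only [Submodule.coe_add]
      rw [iteratedDeriv_add (f.2.1.contDiffAt.of_le hk) (g.2.1.contDiffAt.of_le hk), ← add_mul]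
      exact mul_le_mul_of_nonneg_right (norm_add_le _ _) (by positivity))
    (by
      intro c f
      rw [Real.mul_iSup_of_nonneg (norm_nonneg c)]
      refine iSup_congr fun x => ?_
      simp only [Submodule.coe_smul]
      rw [iteratedDeriv_const_smul (f.2.1.contDiffAt.of_le (natCast_le_smooth k)), norm_smul,
        mul_assoc])

/-- The weighted derivative `e^(ε x² / 2) f^(k)(x)`. -/
noncomputable def weightedDeriv (ε : ℝ) (k : ℕ) (f : ℝ → ℂ) (x : ℝ) : ℂ :=
  (Real.exp (ε * x ^ 2 / 2) : ℂ) * iteratedDeriv k f x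

theorem norm_weightedDeriv_sq (ε : ℝ) (k : ℕ) (f : ℝ → ℂ) (x : ℝ) :
    ‖weightedDeriv ε k f x‖ ^ 2 = Real.exp (ε * x ^ 2) * ‖iteratedDeriv k f x‖ ^ 2 := by
  rw [weightedDeriv, norm_mul, mul_pow, Complex.norm_real, Real.norm_eq_abs, sq_abs,
    ← Real.exp_nat_mul]
  congr 2
  push_cast
  ring

theorem continuous_weightedDeriv (ε : ℝ) (k : ℕ) {f : ℝ → ℂ} (hf : ContDiff ℝ ∞ f) :
    Continuous (weightedDeriv ε k f) := by
  have := hf.continuous_iteratedDeriv k (natCast_le_smooth k)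
  unfold weightedDeriv
  fun_prop

theorem integrable_iff_memLp (ε : ℝ) (k : ℕ) {f : ℝ → ℂ} (hf : ContDiff ℝ ∞ f) :
    MeasureTheory.Integrable (fun x : ℝ => Real.exp (ε * x ^ 2) * ‖iteratedDeriv k f x‖ ^ 2) ↔
      MeasureTheory.MemLp (weightedDeriv ε k f) 2 := by
  rw [MeasureTheory.memLp_two_iff_integrable_sq_norm
    (continuous_weightedDeriv ε k hf).aestronglyMeasurable]
  simp only [norm_weightedDeriv_sq]

theorem weightedDeriv_add (ε : ℝ) (k : ℕ) {f g : ℝ → ℂ} (hf : ContDiff ℝ ∞ f)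
    (hg : ContDiff ℝ ∞ g) :
    weightedDeriv ε k (f + g) = weightedDeriv ε k f + weightedDeriv ε k g := by
  have hk := natCast_le_smooth k
  funext x
  simp only [weightedDeriv, Pi.add_apply]
  rw [iteratedDeriv_add (hf.contDiffAt.of_le hk) (hg.contDiffAt.of_le hk), mul_add]

theorem weightedDeriv_smul (ε : ℝ) (k : ℕ) (c : ℂ) {f : ℝ → ℂ} (hf : ContDiff ℝ ∞ f) :
    weightedDeriv ε k (c • f) = c • weightedDeriv ε k f := by
  funext x
  simp only [weightedDeriv, Pi.smul_apply]
  rw [iteratedDeriv_const_smul (hf.contDiffAt.of_le (natCast_le_smooth k)), mul_smul_comm]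

/-- The space `𝓓_ε`: smooth functions `f : ℝ → ℂ` with `∫ e^(ε x²) |f^(k)(x)|² dx < ∞` for
every `k`. -/
def expDecaySpace (ε : ℝ) : Submodule ℂ (ℝ → ℂ) where
  carrier := {f | ContDiff ℝ ∞ f ∧
    ∀ k : ℕ, MeasureTheory.Integrable
      (fun x : ℝ => Real.exp (ε * x ^ 2) * ‖iteratedDeriv k f x‖ ^ 2)}
  add_mem' := by
    rintro f g ⟨hf, hf'⟩ ⟨hg, hg'⟩
    have hfg : ContDiff ℝ ∞ (f + g) := hf.add hg
    refine ⟨hfg, fun k => ?_⟩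
    rw [integrable_iff_memLp ε k hfg, weightedDeriv_add ε k hf hg]
    exact ((integrable_iff_memLp ε k hf).1 (hf' k)).add ((integrable_iff_memLp ε k hg).1 (hg' k))
  zero_mem' := ⟨contDiff_const, fun k => by simp⟩
  smul_mem' := by
    rintro c f ⟨hf, hf'⟩
    have hcf : ContDiff ℝ ∞ (c • f) := hf.const_smul c
    refine ⟨hcf, fun k => ?_⟩
    rw [integrable_iff_memLp ε k hcf, weightedDeriv_smul ε k c hf]
    exact ((integrable_iff_memLp ε k hf).1 (hf' k)).const_smul c

theorem sqrt_integral_eq (ε : ℝ) (k : ℕ) {f : ℝ → ℂ} (hf : ContDiff ℝ ∞ f) :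
    √(∫ x : ℝ, Real.exp (ε * x ^ 2) * ‖iteratedDeriv k f x‖ ^ 2) =
      MeasureTheory.lpNorm (weightedDeriv ε k f) 2 MeasureTheory.volume := by
  rw [MeasureTheory.lpNorm_eq_integral_norm_rpow_toReal two_ne_zero ENNReal.ofNat_ne_top
    (continuous_weightedDeriv ε k hf).aestronglyMeasurable, Real.sqrt_eq_rpow]
  simp only [ENNReal.toReal_ofNat, Real.rpow_ofNat, norm_weightedDeriv_sq, one_div]

/-- The seminorm `p_{k,ε}(f) = (∫ e^(ε x²) |f^(k)(x)|² dx)^(1/2)` of the Fréchet space `𝓓_ε`. -/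
noncomputable def expDecaySeminorm (ε : ℝ) (k : ℕ) : Seminorm ℂ (expDecaySpace ε) :=
  Seminorm.of
    (fun f => √(∫ x : ℝ, Real.exp (ε * x ^ 2) * ‖iteratedDeriv k (f : ℝ → ℂ) x‖ ^ 2))
    (by
      intro f g
      rw [sqrt_integral_eq ε k f.2.1, sqrt_integral_eq ε k g.2.1, sqrt_integral_eq ε k (f + g).2.1,
        Submodule.coe_add, weightedDeriv_add ε k f.2.1 g.2.1]
      exact MeasureTheory.lpNorm_add_le ((integrable_iff_memLp ε k f.2.1).1 (f.2.2 k)) one_le_two)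
    (by
      intro c f
      rw [sqrt_integral_eq ε k f.2.1, sqrt_integral_eq ε k (c • f).2.1, Submodule.coe_smul,
        weightedDeriv_smul ε k c f.2.1, MeasureTheory.lpNorm_const_smul]
      rfl)

/-! ### Completed projective tensor products -/

section Projective

variable {ι : Type} [Fintype ι] {E : ι → Type} [∀ j, AddCommGroup (E j)] [∀ j, Module ℂ (E j)]

/-- The value `∑ |c| ∏ j, p_j(v_j)` of a formal sum of terms `c ⊗_j v_j`. -/
noncomputable def formalCost (p : ∀ j, Seminorm ℂ (E j)) (w : FreeAddMonoid (ℂ × ∀ j, E j)) : ℝ :=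
  (w.toList.map fun a => ‖a.1‖ * ∏ j, p j (a.2 j)).sum

theorem formalCost_nonneg (p : ∀ j, Seminorm ℂ (E j)) (w : FreeAddMonoid (ℂ × ∀ j, E j)) :
    0 ≤ formalCost p w := by
  refine List.sum_nonneg fun a ha => ?_
  simp only [List.mem_map] at ha
  obtain ⟨b, _, rfl⟩ := ha
  exact mul_nonneg (norm_nonneg _) (Finset.prod_nonneg fun j _ => apply_nonneg _ _)

theorem formalCost_bdd (p : ∀ j, Seminorm ℂ (E j)) (t : ⨂[ℂ] j, E j) :
    BddBelow (Set.range fun w : t.lifts => formalCost p w.1) :=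
  ⟨0, by rintro _ ⟨w, rfl⟩; exact formalCost_nonneg p w.1⟩

/-- The projective tensor product `p_0 ⊗ ⋯ ⊗ p_n` of seminorms: the infimum of
`∑_i |c_i| ∏_j p_j(v_{i,j})` over all ways of writing the tensor as `∑_i c_i ⊗_j v_{i,j}`. -/
noncomputable def projSeminorm (p : ∀ j, Seminorm ℂ (E j)) : Seminorm ℂ (⨂[ℂ] j, E j) :=
  Seminorm.ofSMulLE (fun t => ⨅ w : t.lifts, formalCost p w.1)
    (le_antisymm
      ((ciInf_le (formalCost_bdd p 0) ⟨0, PiTensorProduct.lifts_zero⟩).trans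
        (by simp [formalCost]))
      (le_ciInf fun w => formalCost_nonneg p w.1))
    (fun s t => le_ciInf_add_ciInf fun v w =>
      ciInf_le_of_le (formalCost_bdd p _) ⟨v.1 + w.1, PiTensorProduct.lifts_add v.2 w.2⟩
        (by simp [formalCost]))
    (fun c t => by
      rw [Real.mul_iInf_of_nonneg (norm_nonneg _)]
      refine le_ciInf fun w => ?_
      refine ciInf_le_of_le (formalCost_bdd p _) ⟨_, PiTensorProduct.lifts_smul w.2 c⟩ (le_of_eq ?_)
      simp [formalCost, Function.comp_def, mul_assoc, List.sum_map_mul_left])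

end Projective

section Image

variable {ι : Type} [Fintype ι]

/-- The natural map from the algebraic tensor product of spaces of functions on `ℝ` to functions
of several variables, `⊗_j f_j ↦ (x ↦ ∏_j f_j(x_j))`. -/
noncomputable def toFunction (E : ι → Submodule ℂ (ℝ → ℂ)) :
    (⨂[ℂ] j, E j) →ₗ[ℂ] ((ι → ℝ) → ℂ) :=
  LinearMap.pi fun x => PiTensorProduct.lift
    ((MultilinearMap.mkPiAlgebra ℂ ι ℂ).compLinearMap
      fun j => (LinearMap.proj (x j)).comp (E j).subtype)

/-- The image, in functions of several variables, of the completed projective tensor product of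
the spaces `E j`, where the topology of `E j` is given by the increasing sequence of seminorms
`p j 0 ≤ p j 1 ≤ ⋯`.  The projective topology is given by the seminorms `⊗_j p j r`,
`r = 0, 1, …`; elements of the completion are classes of Cauchy sequences `u` of algebraic
tensors, and the natural map sends such a class to the limit of the functions given by `u`. -/
noncomputable def completedTensorImage (E : ι → Submodule ℂ (ℝ → ℂ))
    (p : ∀ j, ℕ → Seminorm ℂ (E j)) : Submodule ℂ ((ι → ℝ) → ℂ) where
  carrier := {f | ∃ u : ℕ → ⨂[ℂ] j, E j,
    (∀ r : ℕ, ∀ δ > 0, ∃ N : ℕ, ∀ a ≥ N, ∀ b ≥ N,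
      projSeminorm (fun j => p j r) (u a - u b) < δ) ∧
    ∀ x : ι → ℝ, Filter.Tendsto (fun a => toFunction E (u a) x) Filter.atTop (nhds (f x))}
  add_mem' := by
    rintro f g ⟨u, hu, hf⟩ ⟨v, hv, hg⟩
    refine ⟨u + v, fun r δ hδ => ?_, fun x => ?_⟩
    · obtain ⟨N, hN⟩ := hu r (δ / 2) (half_pos hδ)
      obtain ⟨M, hM⟩ := hv r (δ / 2) (half_pos hδ)
      refine ⟨max N M, fun a ha b hb => ?_⟩
      have h1 := hN a (le_of_max_le_left ha) b (le_of_max_le_left hb)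
      have h2 := hM a (le_of_max_le_right ha) b (le_of_max_le_right hb)
      have h3 := map_add_le_add (projSeminorm fun j => p j r) (u a - u b) (v a - v b)
      have h4 : (u + v) a - (u + v) b = u a - u b + (v a - v b) := by
        simp only [Pi.add_apply]; abel
      rw [h4]
      linarith
    · simpa using (hf x).add (hg x)
  zero_mem' := ⟨0, fun r δ hδ => ⟨0, fun a _ b _ => by simpa using hδ⟩, fun x => by simp⟩
  smul_mem' := by
    rintro c f ⟨u, hu, hf⟩
    refine ⟨c • u, fun r δ hδ => ?_, fun x => ?_⟩
    · have hc : 0 < ‖c‖ + 1 := by positivity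
      obtain ⟨N, hN⟩ := hu r (δ / (‖c‖ + 1)) (div_pos hδ hc)
      refine ⟨N, fun a ha b hb => ?_⟩
      have h1 := hN a ha b hb
      rw [lt_div_iff₀ hc] at h1
      have h2 : (c • u) a - (c • u) b = c • (u a - u b) := by
        simp only [Pi.smul_apply, smul_sub]
      rw [h2, map_smul_eq_mul]
      have h3 : 0 ≤ projSeminorm (fun j => p j r) (u a - u b) := apply_nonneg _ _
      nlinarith
    · simpa using (hf x).const_smul c

end Image

/-! ### The spaces `𝓕^(n)` -/

/-- The factor in one slot: `𝓓_{1/m}` if `d` is true, and `Σ^(m)` otherwise. -/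
noncomputable def slotSpace (d : Bool) (m : ℕ) : Submodule ℂ (ℝ → ℂ) :=
  match d with
  | true => expDecaySpace (1 / (m : ℝ))
  | false => symbolSpace m

/-- The increasing sequence of seminorms `max_{k ≤ r} p_k` on a factor, with `p_k` the defining
seminorms of `𝓓_{1/m}`, respectively of `Σ^(m)`. -/
noncomputable def slotSeminorm (d : Bool) (m r : ℕ) : Seminorm ℂ (slotSpace d m) :=
  match d with
  | true => (Finset.range (r + 1)).sup (expDecaySeminorm (1 / (m : ℝ)))
  | false => (Finset.range (r + 1)).sup (symbolSeminorm m)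

/-- The image in functions on `ℝ^(n+1)` of
`Σ^(m_0) ⊗̂ ⋯ ⊗̂ Σ^(m_{k-1}) ⊗̂ 𝓓_{1/m_k} ⊗̂ Σ^(m_{k+1}) ⊗̂ ⋯ ⊗̂ Σ^(m_n)`. -/
noncomputable def FkSpace (n : ℕ) (k : Fin (n + 1)) (m : Fin (n + 1) → ℕ) :
    Submodule ℂ ((Fin (n + 1) → ℝ) → ℂ) :=
  completedTensorImage (fun j => slotSpace (decide (j = k)) (m j))
    (fun j r => slotSeminorm (decide (j = k)) (m j) r)

/-- The space `𝓕^(n)`: the sum over `k` of the unions of the (increasing) spaces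
`𝓕_k(m_0, …, m_n)`, as `m_0, …, m_n → ∞`. -/
noncomputable def FSpace (n : ℕ) : Submodule ℂ ((Fin (n + 1) → ℝ) → ℂ) :=
  ⨆ (k : Fin (n + 1)) (m : Fin (n + 1) → ℕ) (_ : 0 < m k), FkSpace n k m

/-! ### The differential, the grading and the homology -/

/-- The differential `b_ev`, on functions of `n + 2` variables: on `a_0 ⊗ ⋯ ⊗ a_{n+1}` it is
`∑_{i ≤ n} (-1)^i a_0 ⊗ ⋯ ⊗ a_i a_{i+1} ⊗ ⋯ ⊗ a_{n+1} + (-1)^(n+1) α(a_{n+1}) a_0 ⊗ ⋯ ⊗ a_n`,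
where `α(a)(x) = a(-x)`. -/
noncomputable def bEv (n : ℕ) : ((Fin (n + 2) → ℝ) → ℂ) →ₗ[ℂ] ((Fin (n + 1) → ℝ) → ℂ) where
  toFun f x := (∑ i : Fin (n + 1), (-1 : ℂ) ^ (i : ℕ) * f fun j => x (i.predAbove j)) +
    (-1 : ℂ) ^ (n + 1) * f (Fin.snoc x (-(x 0)))
  map_add' f g := by
    funext x
    simp only [Pi.add_apply, mul_add, Finset.sum_add_distrib]
    ring
  map_smul' c f := by
    funext x
    simp only [Pi.smul_apply, smul_eq_mul, RingHom.id_apply, mul_add, Finset.mul_sum]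
    congr 1
    · exact Finset.sum_congr rfl fun i _ => by ring
    · ring

/-- The grading automorphism `α ⊗ ⋯ ⊗ α`, `(α f)(x) = f(-x)`. -/
def grading (n : ℕ) : ((Fin (n + 1) → ℝ) → ℂ) →ₗ[ℂ] ((Fin (n + 1) → ℝ) → ℂ) where
  toFun f x := f (-x)
  map_add' _ _ := rfl
  map_smul' _ _ := rfl

/-- The cycles of degree `n` of the complex `(𝓕^(n), b_ev)`. -/
noncomputable def cycles : (n : ℕ) → Submodule ℂ ((Fin (n + 1) → ℝ) → ℂ)
  | 0 => FSpace 0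
  | n + 1 => FSpace (n + 1) ⊓ LinearMap.ker (bEv n)

/-- The boundaries of degree `n` of the complex `(𝓕^(n), b_ev)`. -/
noncomputable def boundaries (n : ℕ) : Submodule ℂ ((Fin (n + 1) → ℝ) → ℂ) :=
  (FSpace (n + 1)).map (bEv n)

/-- The homology of the complex `(𝓕^(n), b_ev)`, cycles modulo boundaries. -/
abbrev Homology (n : ℕ) : Type := cycles n ⧸ (boundaries n).submoduleOf (cycles n)

/-- The homology class of a cycle. -/
noncomputable def homologyClass (n : ℕ) : cycles n →ₗ[ℂ] Homology n :=
  ((boundaries n).submoduleOf (cycles n)).mkQ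

end EvenHochschild

/-!
The spaces `𝓕^(n)` are stable under few but sufficient operations.  An element of a completed
projective tensor product is the sum of an absolutely convergent series of elementary tensors
(`mem_completedTensorImage_iff`), so an operation which acts on elementary tensors one slot at a
time, with bounds, acts on `𝓕^(n)`.  In this way `𝓕` is closed under substitutions and products with
functions of one variable (`substMap_mem`) and under division by a coordinate
(`exists_div_coord`): every `f ∈ 𝓕^(n)` is `x_l g + e^(-x_l²) f|_{x_l = 0}` with `g ∈ 𝓕^(n)`.  The
estimates for one slot are phrased with pointwise bounds (`SlotBound`), which are equivalent to the
defining seminorms up to a change of the order `m`.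

The complex computes a Hochschild homology twisted by `x ↦ -x`, hence is concentrated at the fixed
point `0`.  Concretely, the shuffle product `h` with the coordinate function satisfies
`b h + h b = 2 x_0` (`bEv_shuffle`), so a cycle divisible by `x_0` is a boundary: if `f = x_0 k` is
a cycle then so is `k`, by continuity, and `f = b (h k / 2)`.  In degree `0` this leaves the value
at the origin, which vanishes on boundaries, and so the class of `e^(-x²)` generates.

In positive degree a cycle has to be corrected by boundaries until it vanishes for `x_0 = 0`.  On
this fibre the complex is the bar complex of the algebra of symbols with coefficients in the
character `f ↦ f(0)` on both sides, and there is no decay condition left, since the factor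
`e^(-x_0²)` provides it.  Inserting the function `1` as a new first variable makes the restriction
of the cycle to the fibre divisible by `x_1`, and inserting the coordinate function then kills it
(`bEv_fibreInsert`).  The only obstruction, in degree `1`, is the derivative of `f(0, x_1)` at the
origin.  It vanishes because `f(t, t) = f(t, -t)` (`bEv_sub_degenerate_eq_zero`).
-/

namespace EvenHochschild

/-! ### Completed tensor products as spaces of series -/

section Series

variable {ι : Type} [Fintype ι]

theorem toFunction_smul_tprod (E : ι → Submodule ℂ (ℝ → ℂ)) (c : ℂ) (v : ∀ j, E j) (x : ι → ℝ) :
    toFunction E (c • PiTensorProduct.tprod ℂ v) x = c * ∏ j, (v j : ℝ → ℂ) (x j) := by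
  simp [toFunction]

theorem projSeminorm_smul_tprod_le {E : ι → Type} [∀ j, AddCommGroup (E j)]
    [∀ j, Module ℂ (E j)] (p : ∀ j, Seminorm ℂ (E j)) (c : ℂ) (v : ∀ j, E j) :
    projSeminorm p (c • PiTensorProduct.tprod ℂ v) ≤ ‖c‖ * ∏ j, p j (v j) := by
  have hmem : FreeAddMonoid.of (c, v) ∈ (c • PiTensorProduct.tprod ℂ v).lifts := by
    rw [PiTensorProduct.mem_lifts_iff]
    simp
  refine (ciInf_le (formalCost_bdd p _) ⟨_, hmem⟩).trans (le_of_eq ?_)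
  simp [formalCost]

theorem exists_list_of_projSeminorm_lt {E : ι → Type} [∀ j, AddCommGroup (E j)]
    [∀ j, Module ℂ (E j)] (p : ∀ j, Seminorm ℂ (E j)) {t : ⨂[ℂ] j, E j} {δ : ℝ}
    (h : projSeminorm p t < δ) :
    ∃ w : List (ℂ × ∀ j, E j), (w.map fun a => a.1 • PiTensorProduct.tprod ℂ a.2).sum = t ∧
      (w.map fun a => ‖a.1‖ * ∏ j, p j (a.2 j)).sum < δ := by
  have : Nonempty t.lifts := (PiTensorProduct.nonempty_lifts t).to_subtype
  obtain ⟨w, hw⟩ := exists_lt_of_ciInf_lt h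
  exact ⟨w.1.toList, (PiTensorProduct.mem_lifts_iff _ _).1 w.2, hw⟩

/-- Functions in the image of the completed projective tensor product are the sums of absolutely
convergent series of elementary tensors. -/
theorem mem_completedTensorImage_iff (E : ι → Submodule ℂ (ℝ → ℂ))
    (p : ∀ j, ℕ → Seminorm ℂ (E j)) (hp : ∀ j, Monotone (p j)) (r₀ : ℕ)
    (heval : ∀ j (y : ℝ), ∃ C : ℝ, ∀ v : E j, ‖(v : ℝ → ℂ) y‖ ≤ C * p j r₀ v)
    (f : (ι → ℝ) → ℂ) :
    f ∈ completedTensorImage E p ↔ ∃ (c : ℕ → ℂ) (v : ℕ → ∀ j, E j),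
      (∀ r, Summable fun i => ‖c i‖ * ∏ j, p j r (v i j)) ∧
      ∀ x : ι → ℝ, HasSum (fun i => c i * ∏ j, (v i j : ℝ → ℂ) (x j)) (f x) := by
  constructor
  · rintro ⟨u, hu, hf⟩
    choose N hN using fun r : ℕ => hu r ((1 / 2) ^ r) (by positivity)
    -- a subsequence along which consecutive differences decay geometrically
    let A : ℕ → ℕ := fun r => r + ∑ s ∈ Finset.range (r + 1), N s
    have hAN : ∀ r, N r ≤ A r := fun r =>
      (Finset.single_le_sum (f := N) (fun _ _ => Nat.zero_le _)
        (Finset.mem_range.2 (Nat.lt_succ_self r))).trans (Nat.le_add_left _ _)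
    have hAmono : StrictMono A := by
      refine strictMono_nat_of_lt_succ fun r => ?_
      simp only [A, Finset.sum_range_succ _ (r + 1)]
      omega
    let t : ℕ → ⨂[ℂ] j, E j := fun r => Nat.casesOn r (u (A 0)) fun r => u (A (r + 1)) - u (A r)
    have ht : ∀ n, ∑ r ∈ Finset.range (n + 1), t r = u (A n) := by
      intro n
      induction n with
      | zero => simp [t]
      | succ n ih => rw [Finset.sum_range_succ, ih]; simp [t]
    have hlist : ∀ r, ∃ w : List (ℂ × ∀ j, E j),
        (w.map fun a => a.1 • PiTensorProduct.tprod ℂ a.2).sum = t r ∧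
        ∀ s, s < r → (w.map fun a => ‖a.1‖ * ∏ j, p j s (a.2 j)).sum ≤ 2 * (1 / 2) ^ r := by
      intro r
      cases r with
      | zero =>
        obtain ⟨w, hw, -⟩ := exists_list_of_projSeminorm_lt (fun j => p j 0)
          (lt_add_one (projSeminorm (fun j => p j 0) (t 0)))
        exact ⟨w, hw, fun s hs => absurd hs (Nat.not_lt_zero s)⟩
      | succ r =>
        obtain ⟨w, hw, hw'⟩ := exists_list_of_projSeminorm_lt (fun j => p j r) (t := t (r + 1))
          (hN r (A (r + 1)) ((hAN r).trans (hAmono.monotone (Nat.le_succ r))) (A r) (hAN r))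
        refine ⟨w, hw, fun s hs => ?_⟩
        refine le_trans (List.sum_le_sum fun a _ => ?_) (hw'.le.trans (le_of_eq (by ring)))
        exact mul_le_mul_of_nonneg_left (Finset.prod_le_prod (fun j _ => apply_nonneg _ _)
          fun j _ => hp j (Nat.lt_succ_iff.1 hs) _) (norm_nonneg _)
    choose w hw hcost using hlist
    -- all terms of the chosen representations of the differences form the series
    let I : Type := Σ r, Fin (w r).length
    let c : I → ℂ := fun i => ((w i.1).get i.2).1
    let v : I → ∀ j, E j := fun i => ((w i.1).get i.2).2
    have hsum : ∀ s, Summable fun i : I => ‖c i‖ * ∏ j, p j s (v i j) := by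
      intro s
      have hnn : ∀ i : I, 0 ≤ ‖c i‖ * ∏ j, p j s (v i j) := fun i =>
        mul_nonneg (norm_nonneg _) (Finset.prod_nonneg fun j _ => apply_nonneg _ _)
      refine (summable_sigma_of_nonneg hnn).2 ⟨fun r => (hasSum_fintype _).summable, ?_⟩
      have hval : ∀ r, ∑' i : Fin (w r).length, ‖c ⟨r, i⟩‖ * ∏ j, p j s (v ⟨r, i⟩ j) =
          ((w r).map fun a => ‖a.1‖ * ∏ j, p j s (a.2 j)).sum := by
        intro r
        rw [tsum_fintype, ← Fin.sum_univ_fun_getElem]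
        rfl
      have hg : Summable fun r : ℕ => (2 : ℝ) * (1 / 2) ^ r := summable_geometric_two.mul_left 2
      rw [← summable_nat_add_iff (s + 1)] at hg ⊢
      refine Summable.of_nonneg_of_le (fun r => tsum_nonneg fun i => hnn _) (fun r => ?_) hg
      rw [hval]
      exact hcost _ s (by omega)
    have hpt : ∀ x : ι → ℝ, HasSum (fun i => c i * ∏ j, (v i j : ℝ → ℂ) (x j)) (f x) := by
      intro x
      choose C hC using fun j => heval j (x j)
      have hs : Summable fun i => c i * ∏ j, (v i j : ℝ → ℂ) (x j) := by
        refine Summable.of_norm_bounded ((hsum r₀).mul_left (∏ j, C j)) fun i => ?_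
        rw [norm_mul, norm_prod, mul_left_comm, ← Finset.prod_mul_distrib]
        exact mul_le_mul_of_nonneg_left (Finset.prod_le_prod (fun j _ => norm_nonneg _)
          fun j _ => hC j _) (norm_nonneg _)
      obtain ⟨a, ha⟩ := hs
      have h1 := (HasSum.sigma ha fun r => hasSum_fintype _).tendsto_sum_nat
      have h2 : ∀ r, ∑ i : Fin (w r).length, c ⟨r, i⟩ * ∏ j, (v ⟨r, i⟩ j : ℝ → ℂ) (x j) =
          toFunction E (t r) x := by
        intro r
        rw [← hw r, map_list_sum, List.map_map, ← Fin.sum_univ_fun_getElem, Finset.sum_apply]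
        exact Finset.sum_congr rfl fun i _ => (toFunction_smul_tprod E _ _ x).symm
      simp only [h2] at h1
      have h3 := (hf x).comp hAmono.tendsto_atTop
      have h4 := h1.comp (Filter.tendsto_add_atTop_nat 1)
      have h5 : ((fun n => ∑ r ∈ Finset.range n, toFunction E (t r) x) ∘ fun a => a + 1) =
          (fun a => toFunction E (u a) x) ∘ A := by
        funext n
        simp only [Function.comp_apply]
        rw [← ht n, map_sum, Finset.sum_apply]
      rw [h5] at h4
      rwa [tendsto_nhds_unique h3 h4]
    -- reindex by `ℕ`, with zero terms off the range of `e`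
    obtain ⟨e, he⟩ := exists_injective_nat I
    refine ⟨Function.extend e c 0, Function.extend e v 0, fun r => ?_, fun x => ?_⟩
    · have := (he.summable_iff (f := fun i => ‖Function.extend e c 0 i‖ *
        ∏ j, p j r (Function.extend e v 0 i j)) fun i hi => by
          rw [Function.extend_apply' _ _ _ (by simpa using hi)]; simp).1
      refine this ?_
      simpa [Function.comp_def, he.extend_apply] using hsum r
    · have := (he.hasSum_iff (f := fun i => Function.extend e c 0 i *
        ∏ j, (Function.extend e v 0 i j : ℝ → ℂ) (x j)) (a := f x) fun i hi => by
          rw [Function.extend_apply' _ _ _ (by simpa using hi)]; simp).1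
      refine this ?_
      simpa [Function.comp_def, he.extend_apply] using hpt x
  · rintro ⟨c, v, hsum, hf⟩
    refine ⟨fun a => ∑ i ∈ Finset.range a, c i • PiTensorProduct.tprod ℂ (v i), ?_, fun x => ?_⟩
    · intro r δ hδ
      have hnn : ∀ i, 0 ≤ ‖c i‖ * ∏ j, p j r (v i j) := fun i =>
        mul_nonneg (norm_nonneg _) (Finset.prod_nonneg fun j _ => apply_nonneg _ _)
      have hle : ∀ a b, a ≤ b → projSeminorm (fun j => p j r)
          (∑ i ∈ Finset.range b, c i • PiTensorProduct.tprod ℂ (v i) -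
            ∑ i ∈ Finset.range a, c i • PiTensorProduct.tprod ℂ (v i)) ≤
          ∑ i ∈ Finset.range b, ‖c i‖ * ∏ j, p j r (v i j) -
            ∑ i ∈ Finset.range a, ‖c i‖ * ∏ j, p j r (v i j) := by
        intro a b hab
        rw [← Finset.sum_Ico_eq_sub _ hab,
          ← Finset.sum_Ico_eq_sub (fun i => c i • PiTensorProduct.tprod ℂ (v i)) hab]
        exact (Finset.le_sum_of_subadditive _ (map_zero _).le (map_add_le_add _) _ _).trans
          (Finset.sum_le_sum fun i _ => projSeminorm_smul_tprod_le _ _ _)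
      obtain ⟨N, hN⟩ := Metric.cauchySeq_iff.1 (hsum r).hasSum.tendsto_sum_nat.cauchySeq δ hδ
      refine ⟨N, fun a ha b hb => ?_⟩
      have hd := hN a ha b hb
      rw [Real.dist_eq] at hd
      rcases le_total a b with hab | hab
      · refine (map_sub_rev (projSeminorm fun j => p j r) _ _).trans_lt ?_
        refine (hle a b hab).trans_lt ((le_abs_self _).trans_lt ?_)
        rwa [abs_sub_comm]
      · exact (hle b a hab).trans_lt ((le_abs_self _).trans_lt hd)
    · have := (hf x).tendsto_sum_nat
      simpa only [map_sum, Finset.sum_apply, toFunction_smul_tprod] using this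

end Series

/-! ### Pointwise bounds in one variable -/

/-- The weight controlling the `k`-th derivative in one slot: `e^(-x²/M)` in a Gaussian slot
(`d` true), and `(1 + |x|)^(M - k)` in a symbol slot. -/
noncomputable def slotWeight (d : Bool) (M k : ℕ) (x : ℝ) : ℝ :=
  match d with
  | true => Real.exp (-(x ^ 2 / M))
  | false => (1 + |x|) ^ ((M : ℤ) - (k : ℤ))

/-- The function `g` is smooth, and its derivatives of order at most `r` are bounded by `B` times
the weights `slotWeight d M`. -/
structure SlotBound (d : Bool) (M r : ℕ) (B : ℝ) (g : ℝ → ℂ) : Prop where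
  smooth : ContDiff ℝ ∞ g
  bound : ∀ k ≤ r, ∀ x, ‖iteratedDeriv k g x‖ ≤ B * slotWeight d M k x

theorem slotWeight_pos (d : Bool) (M k : ℕ) (x : ℝ) : 0 < slotWeight d M k x := by
  cases d <;> simp only [slotWeight] <;> positivity

theorem slotWeight_mono {M M' : ℕ} (hM : 0 < M) (h : M ≤ M') (d : Bool) (k : ℕ) (x : ℝ) :
    slotWeight d M k x ≤ slotWeight d M' k x := by
  cases d
  · exact zpow_le_zpow_right₀ (by linarith [abs_nonneg x]) (by omega)
  · have : (M : ℝ) ≤ M' := by exact_mod_cast h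
    have : (0 : ℝ) < M := by exact_mod_cast hM
    simp only [slotWeight]
    gcongr

theorem continuous_slotWeight (d : Bool) (M k : ℕ) : Continuous (slotWeight d M k) := by
  cases d
  · refine Continuous.zpow₀ (by fun_prop) _ fun x => Or.inl ?_
    positivity
  · show Continuous fun x : ℝ => Real.exp (-(x ^ 2 / M))
    fun_prop

theorem exists_pow_le_exp_sq (N : ℕ) {δ : ℝ} (hδ : 0 < δ) :
    ∃ C : ℝ, 0 ≤ C ∧ ∀ x : ℝ, (1 + |x|) ^ N ≤ C * Real.exp (δ * x ^ 2) := by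
  -- from `t^N ≤ N! e^t` and `|x| ≤ 1 / (4 δ) + δ x²`
  refine ⟨N.factorial * Real.exp (1 + 1 / (4 * δ)), by positivity, fun x => ?_⟩
  have h1 := Real.pow_div_factorial_le_exp (1 + |x|) (by positivity) N
  rw [div_le_iff₀ (by positivity)] at h1
  have h2 : 1 + |x| ≤ 1 + 1 / (4 * δ) + δ * x ^ 2 := by
    have h3 : 1 / (4 * δ) + δ * x ^ 2 - |x| = δ * (|x| - 1 / (2 * δ)) ^ 2 := by
      rw [← sq_abs x]
      field_simp
      ring
    have h4 : 0 ≤ δ * (|x| - 1 / (2 * δ)) ^ 2 := by positivity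
    linarith
  calc (1 + |x|) ^ N ≤ Real.exp (1 + |x|) * N.factorial := h1
    _ ≤ Real.exp (1 + 1 / (4 * δ) + δ * x ^ 2) * N.factorial := by gcongr
    _ = _ := by rw [Real.exp_add (1 + 1 / (4 * δ))]; ring

theorem exists_gauss_mul_pow_le {M M' : ℕ} (hM : 0 < M) (h : M < M') (N : ℕ) :
    ∃ C : ℝ, 0 ≤ C ∧ ∀ x : ℝ,
      Real.exp (-(x ^ 2 / M)) * (1 + |x|) ^ N ≤ C * Real.exp (-(x ^ 2 / M')) := by
  have hM0 : (0 : ℝ) < M := by exact_mod_cast hM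
  have hMM : (M : ℝ) < M' := by exact_mod_cast h
  obtain ⟨C, hC, hx⟩ := exists_pow_le_exp_sq N (δ := 1 / M - 1 / M')
    (sub_pos.2 (one_div_lt_one_div_of_lt hM0 hMM))
  refine ⟨C, hC, fun x => ?_⟩
  calc Real.exp (-(x ^ 2 / M)) * (1 + |x|) ^ N
      ≤ Real.exp (-(x ^ 2 / M)) * (C * Real.exp ((1 / M - 1 / M') * x ^ 2)) := by
        gcongr
        exact hx x
    _ = C * Real.exp (-(x ^ 2 / M')) := by
        rw [mul_left_comm, ← Real.exp_add]
        congr 2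
        ring

/-- Gaussian decay beats any polynomial growth. -/
theorem exists_slotWeight_true_le_false {M : ℕ} (hM : 0 < M) (r : ℕ) :
    ∃ C : ℝ, 0 ≤ C ∧ ∀ k ≤ r, ∀ x, slotWeight true M k x ≤ C * slotWeight false M k x := by
  obtain ⟨C, hC, h⟩ := exists_gauss_mul_pow_le hM (Nat.lt_succ_self M) r
  refine ⟨C, hC, fun k hk x => ?_⟩
  have hx : (1 : ℝ) ≤ 1 + |x| := by linarith [abs_nonneg x]
  have h1 : Real.exp (-(x ^ 2 / M)) * (1 + |x|) ^ r ≤ C := (h x).trans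
    (mul_le_of_le_one_right hC (Real.exp_le_one_iff.2 (neg_nonpos.2 (by positivity))))
  have h2 : 0 < (1 + |x|) ^ r := by positivity
  rw [← le_div_iff₀ h2] at h1
  refine h1.trans ?_
  rw [div_eq_mul_inv, ← zpow_natCast, ← zpow_neg]
  exact mul_le_mul_of_nonneg_left (zpow_le_zpow_right₀ hx (by omega)) hC

theorem exists_slotWeight_mul_le {M₁ M₂ : ℕ} (h₁ : 0 < M₁) (h₂ : 0 < M₂) (d₁ d₂ : Bool) (r : ℕ) :
    ∃ C : ℝ, 0 ≤ C ∧ ∀ i ≤ r, ∀ j ≤ r, ∀ x, slotWeight d₁ M₁ i x * slotWeight d₂ M₂ j x ≤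
      C * slotWeight (d₁ || d₂) (M₁ + M₂) (i + j) x := by
  have key : ∀ {M N : ℕ}, 0 < M → 0 < N → ∃ C : ℝ, 0 ≤ C ∧ ∀ j : ℕ, ∀ x : ℝ,
      Real.exp (-(x ^ 2 / M)) * (1 + |x|) ^ ((N : ℤ) - (j : ℤ)) ≤
        C * Real.exp (-(x ^ 2 / ((M + N : ℕ) : ℝ))) := by
    intro M N hM hN
    obtain ⟨C, hC, h⟩ := exists_gauss_mul_pow_le hM (Nat.lt_add_of_pos_right hN) N
    refine ⟨C, hC, fun j x => le_trans ?_ (h x)⟩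
    gcongr
    rw [← zpow_natCast]
    exact zpow_le_zpow_right₀ (by linarith [abs_nonneg x]) (by omega)
  cases d₁ <;> cases d₂
  · refine ⟨1, zero_le_one, fun i _ j _ x => le_of_eq ?_⟩
    simp only [slotWeight, Bool.or_false, one_mul]
    rw [← zpow_add₀ (by positivity)]
    congr 1
    push_cast
    ring
  · obtain ⟨C, hC, h⟩ := key h₂ h₁
    refine ⟨C, hC, fun i _ j _ x => ?_⟩
    rw [mul_comm, Bool.or_true, add_comm M₁]
    exact h i x
  · obtain ⟨C, hC, h⟩ := key h₁ h₂
    exact ⟨C, hC, fun i _ j _ x => h j x⟩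
  · refine ⟨1, zero_le_one, fun i _ j _ x => ?_⟩
    rw [one_mul]
    refine (mul_le_of_le_one_right (slotWeight_pos _ _ _ _).le ?_).trans
      (slotWeight_mono h₁ (Nat.le_add_right _ _) true i x)
    exact Real.exp_le_one_iff.2 (neg_nonpos.2 (by positivity))

namespace SlotBound

variable {d : Bool} {M r : ℕ} {B : ℝ} {g : ℝ → ℂ}

theorem nonneg (h : SlotBound d M r B g) : 0 ≤ B :=
  nonneg_of_mul_nonneg_left ((norm_nonneg _).trans (h.bound 0 (Nat.zero_le _) 0))
    (slotWeight_pos _ _ _ _)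

theorem mono_order (h : SlotBound d M r B g) (hM : 0 < M) {M' : ℕ} (hMM : M ≤ M') :
    SlotBound d M' r B g :=
  ⟨h.smooth, fun k hk x => (h.bound k hk x).trans
    (mul_le_mul_of_nonneg_left (slotWeight_mono hM hMM d k x) h.nonneg)⟩

theorem mono_const (h : SlotBound d M r B g) {B' : ℝ} (hB : B ≤ B') : SlotBound d M r B' g :=
  ⟨h.smooth, fun k hk x => (h.bound k hk x).trans
    (mul_le_mul_of_nonneg_right hB (slotWeight_pos _ _ _ _).le)⟩

theorem comp_neg (h : SlotBound d M r B g) : SlotBound d M r B fun x => g (-x) := by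
  refine ⟨h.smooth.comp contDiff_neg, fun k hk x => ?_⟩
  rw [iteratedDeriv_comp_neg, norm_smul, norm_pow, norm_neg, norm_one, one_pow, one_mul]
  refine (h.bound k hk (-x)).trans (le_of_eq ?_)
  cases d <;> simp [slotWeight]

theorem const (hM : 0 < M) (r : ℕ) (z : ℂ) : SlotBound false M r ‖z‖ fun _ => z := by
  refine ⟨contDiff_const, fun k hk x => ?_⟩
  rw [iteratedDeriv_const]
  have h1 := slotWeight_pos false M k x
  split_ifs with hk0
  · subst hk0
    refine le_mul_of_one_le_right (norm_nonneg _) ?_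
    exact one_le_zpow₀ (by linarith [abs_nonneg x]) (by omega)
  · rw [norm_zero]
    positivity

theorem norm_zero_le (h : SlotBound d M r B g) : ‖g 0‖ ≤ B := by
  have := h.bound 0 (Nat.zero_le _) 0
  cases d <;> simpa [slotWeight] using this

end SlotBound

theorem exists_slotBound_mul {M₁ M₂ : ℕ} (h₁ : 0 < M₁) (h₂ : 0 < M₂) (d₁ d₂ : Bool) (r : ℕ) :
    ∃ C : ℝ, 0 ≤ C ∧ ∀ B₁ B₂ g₁ g₂, SlotBound d₁ M₁ r B₁ g₁ → SlotBound d₂ M₂ r B₂ g₂ →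
      SlotBound (d₁ || d₂) (M₁ + M₂) r (C * (B₁ * B₂)) fun x => g₁ x * g₂ x := by
  obtain ⟨C, hC, hw⟩ := exists_slotWeight_mul_le h₁ h₂ d₁ d₂ r
  refine ⟨2 ^ r * C, by positivity, fun B₁ B₂ g₁ g₂ hg₁ hg₂ => ⟨hg₁.smooth.mul hg₂.smooth, ?_⟩⟩
  intro k hk x
  have hk' := natCast_le_smooth k
  have hB₁ := hg₁.nonneg
  have hB₂ := hg₂.nonneg
  rw [iteratedDeriv_fun_mul (hg₁.smooth.contDiffAt.of_le hk') (hg₂.smooth.contDiffAt.of_le hk')]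
  have hterm : ∀ i ∈ Finset.range (k + 1),
      ‖(k.choose i : ℂ) * iteratedDeriv i g₁ x * iteratedDeriv (k - i) g₂ x‖ ≤
        (k.choose i : ℝ) * (C * (B₁ * B₂) * slotWeight (d₁ || d₂) (M₁ + M₂) k x) := by
    intro i hi
    have hik : i ≤ k := Nat.lt_succ_iff.1 (Finset.mem_range.1 hi)
    rw [norm_mul, norm_mul, Complex.norm_natCast, mul_assoc]
    refine mul_le_mul_of_nonneg_left ?_ (Nat.cast_nonneg _)
    calc ‖iteratedDeriv i g₁ x‖ * ‖iteratedDeriv (k - i) g₂ x‖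
        ≤ (B₁ * slotWeight d₁ M₁ i x) * (B₂ * slotWeight d₂ M₂ (k - i) x) :=
          mul_le_mul (hg₁.bound i (hik.trans hk) x) (hg₂.bound _ ((Nat.sub_le k i).trans hk) x)
            (norm_nonneg _) (mul_nonneg hB₁ (slotWeight_pos _ _ _ _).le)
      _ = (B₁ * B₂) * (slotWeight d₁ M₁ i x * slotWeight d₂ M₂ (k - i) x) := by ring
      _ ≤ (B₁ * B₂) * (C * slotWeight (d₁ || d₂) (M₁ + M₂) (i + (k - i)) x) := by
          exact mul_le_mul_of_nonneg_left
            (hw i (hik.trans hk) _ ((Nat.sub_le k i).trans hk) x) (mul_nonneg hB₁ hB₂)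
      _ = _ := by rw [Nat.add_sub_cancel' hik]; ring
  refine (norm_sum_le _ _).trans ((Finset.sum_le_sum hterm).trans ?_)
  rw [← Finset.sum_mul, ← Nat.cast_sum, Nat.sum_range_choose]
  have h2 : ((2 ^ k : ℕ) : ℝ) ≤ 2 ^ r := by
    push_cast
    exact pow_le_pow_right₀ one_le_two hk
  have h3 := (slotWeight_pos (d₁ || d₂) (M₁ + M₂) k x).le
  calc ((2 ^ k : ℕ) : ℝ) * (C * (B₁ * B₂) * slotWeight (d₁ || d₂) (M₁ + M₂) k x)
      ≤ 2 ^ r * (C * (B₁ * B₂) * slotWeight (d₁ || d₂) (M₁ + M₂) k x) := by gcongr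
    _ = _ := by ring

/-- A finite product of functions in symbol and Gaussian slots is Gaussian as soon as one of the
factors is. -/
theorem exists_slotBound_prod {ι : Type} [DecidableEq ι] (s : Finset ι) (d : ι → Bool) {M : ℕ}
    (hM : 0 < M) (r : ℕ) :
    ∃ C : ℝ, 0 ≤ C ∧ ∀ (B : ι → ℝ) (v : ι → ℝ → ℂ), (∀ j, SlotBound (d j) M r (B j) (v j)) →
      SlotBound (s.sup d) ((s.card + 1) * M) r (C * ∏ j ∈ s, B j)
        fun x => ∏ j ∈ s, v j x := by
  induction s using Finset.induction_on with
  | empty =>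
    refine ⟨1, zero_le_one, fun B v _ => ?_⟩
    simpa using SlotBound.const (M := M) hM r 1
  | insert a s ha ih =>
    obtain ⟨C, hC, h⟩ := ih
    obtain ⟨D, hD, h'⟩ := exists_slotBound_mul hM (M₂ := (s.card + 1) * M) (by positivity) (d a)
      (s.sup d) r
    refine ⟨D * C, by positivity, fun B v hv => ?_⟩
    have := h' _ _ _ _ (hv a) (h B v hv)
    rw [Finset.prod_insert ha, Finset.card_insert_of_notMem ha]
    have e1 : (insert a s).sup d = (d a || s.sup d) := Finset.sup_insert
    rw [e1]
    simp only [Finset.prod_insert ha]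
    convert this using 1 <;> ring

/-! ### Gaussian decay in the mean and pointwise -/

/-- A one-dimensional Sobolev inequality on a unit interval. -/
theorem norm_le_integral_add {g : ℝ → ℂ} (hg : ContDiff ℝ 1 g) {a x : ℝ} (h₁ : a ≤ x)
    (h₂ : x ≤ a + 1) : ‖g x‖ ≤ (∫ y in a..a + 1, ‖g y‖) + ∫ y in a..a + 1, ‖deriv g y‖ := by
  have hd : Continuous (deriv g) := hg.continuous_deriv_one
  have key : ∀ y ∈ Set.Icc a (a + 1), ‖g x‖ ≤ ‖g y‖ + ∫ y in a..a + 1, ‖deriv g y‖ := by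
    intro y hy
    have h := intervalIntegral.integral_deriv_eq_sub (f := g) (a := y) (b := x)
      (fun z _ => (hg.differentiable one_ne_zero).differentiableAt) (hd.intervalIntegrable _ _)
    have h3 : ‖∫ z in y..x, deriv g z‖ ≤ ∫ z in a..a + 1, ‖deriv g z‖ := by
      refine intervalIntegral.norm_integral_le_integral_norm_uIoc.trans ?_
      rw [intervalIntegral.integral_of_le (by linarith : a ≤ a + 1)]
      refine MeasureTheory.setIntegral_mono_set
        (intervalIntegrable_iff_integrableOn_Ioc_of_le (by linarith) |>.1
          (hd.norm.intervalIntegrable _ _))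
        (Filter.Eventually.of_forall fun z => norm_nonneg _) (LE.le.eventuallyLE fun z hz => ?_)
      exact ⟨(le_min hy.1 h₁).trans_lt hz.1, hz.2.trans (max_le hy.2 h₂)⟩
    have h4 : g x = g y + ∫ z in y..x, deriv g z := by rw [h]; ring
    rw [h4]
    exact (norm_add_le _ _).trans (by linarith)
  have hgi : IntervalIntegrable (fun y => ‖g y‖) MeasureTheory.volume a (a + 1) :=
    hg.continuous.norm.intervalIntegrable _ _
  have h5 : ∫ _ in a..a + 1, ‖g x‖ ≤
      ∫ y in a..a + 1, (‖g y‖ + ∫ y in a..a + 1, ‖deriv g y‖) :=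
    intervalIntegral.integral_mono_on (by linarith) intervalIntegrable_const
      (hgi.add intervalIntegrable_const) key
  rw [intervalIntegral.integral_add hgi intervalIntegrable_const] at h5
  simpa using h5

/-- The variance of a function on a unit interval is nonnegative. -/
theorem sq_integral_le {h : ℝ → ℝ} (hh : Continuous h) (a : ℝ) :
    (∫ y in a..a + 1, h y) ^ 2 ≤ ∫ y in a..a + 1, h y ^ 2 := by
  set A := ∫ y in a..a + 1, h y
  have h0 : 0 ≤ ∫ y in a..a + 1, (h y - A) ^ 2 :=
    intervalIntegral.integral_nonneg (by linarith) fun y _ => sq_nonneg _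
  have h1 : ∫ y in a..a + 1, (h y - A) ^ 2 = (∫ y in a..a + 1, h y ^ 2) - 2 * A * A + A ^ 2 := by
    have e : ∀ y, (h y - A) ^ 2 = (h y ^ 2 - 2 * A * h y) + A ^ 2 := fun y => by ring
    simp only [e]
    rw [intervalIntegral.integral_add, intervalIntegral.integral_sub,
      intervalIntegral.integral_const_mul, intervalIntegral.integral_const]
    · simp [A]
    all_goals exact Continuous.intervalIntegrable (by fun_prop) _ _
  nlinarith

/-- Cauchy–Schwarz on a unit interval, on which the Gaussian weight is at least its value at `x`. -/
theorem integral_norm_le_of_gauss {ε : ℝ} (hε : 0 ≤ ε) {g : ℝ → ℂ} (hg : Continuous g)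
    (hi : MeasureTheory.Integrable fun y : ℝ => Real.exp (ε * y ^ 2) * ‖g y‖ ^ 2) {a x : ℝ}
    (hx : ∀ y ∈ Set.Icc a (a + 1), x ^ 2 ≤ y ^ 2) :
    ∫ y in a..a + 1, ‖g y‖ ≤
      Real.exp (-(ε * x ^ 2 / 2)) * √(∫ y, Real.exp (ε * y ^ 2) * ‖g y‖ ^ 2) := by
  have hc : Continuous fun y : ℝ => Real.exp (ε * y ^ 2 / 2) * ‖g y‖ := by fun_prop
  have h1 : ∫ y in a..a + 1, ‖g y‖ ≤
      Real.exp (-(ε * x ^ 2 / 2)) * ∫ y in a..a + 1, Real.exp (ε * y ^ 2 / 2) * ‖g y‖ := by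
    rw [← intervalIntegral.integral_const_mul]
    refine intervalIntegral.integral_mono_on (by linarith) (hg.norm.intervalIntegrable _ _)
      ((hc.const_mul _).intervalIntegrable _ _) fun y hy => ?_
    rw [← mul_assoc, ← Real.exp_add]
    refine le_mul_of_one_le_left (norm_nonneg _) (Real.one_le_exp ?_)
    have := mul_le_mul_of_nonneg_left (hx y hy) hε
    linarith
  refine h1.trans ?_
  gcongr
  refine Real.le_sqrt_of_sq_le ((sq_integral_le hc a).trans ?_)
  have e : ∀ y : ℝ, (Real.exp (ε * y ^ 2 / 2) * ‖g y‖) ^ 2 = Real.exp (ε * y ^ 2) * ‖g y‖ ^ 2 := by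
    intro y
    rw [mul_pow, ← Real.exp_nat_mul]
    congr 2
    push_cast
    ring
  simp only [e]
  rw [intervalIntegral.integral_of_le (by linarith)]
  exact MeasureTheory.setIntegral_le_integral hi
    (Filter.Eventually.of_forall fun y => by positivity)

theorem norm_iteratedDeriv_le_of_expDecay {ε : ℝ} (hε : 0 ≤ ε) (f : expDecaySpace ε) (k : ℕ)
    (x : ℝ) : ‖iteratedDeriv k (f : ℝ → ℂ) x‖ ≤
      (expDecaySeminorm ε k f + expDecaySeminorm ε (k + 1) f) * Real.exp (-(ε * x ^ 2 / 2)) := by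
  have hs : ContDiff ℝ ∞ (iteratedDeriv k (f : ℝ → ℂ)) := by
    rw [iteratedDeriv_eq_iterate]
    exact f.2.1.iterate_deriv k
  have hs' : deriv (iteratedDeriv k (f : ℝ → ℂ)) = iteratedDeriv (k + 1) (f : ℝ → ℂ) :=
    iteratedDeriv_succ.symm
  -- the unit interval next to `x` which points away from the origin
  obtain ⟨a, h₁, h₂, ha⟩ : ∃ a : ℝ, a ≤ x ∧ x ≤ a + 1 ∧ ∀ y ∈ Set.Icc a (a + 1), x ^ 2 ≤ y ^ 2 := by
    rcases le_total 0 x with h | h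
    · exact ⟨x, le_rfl, by linarith, fun y hy => pow_le_pow_left₀ h hy.1 2⟩
    · refine ⟨x - 1, by linarith, by linarith, fun y hy => ?_⟩
      have : y ≤ x := by linarith [hy.2]
      nlinarith
  refine (norm_le_integral_add (hs.of_le (by simp)) h₁ h₂).trans ?_
  rw [hs']
  have e1 := integral_norm_le_of_gauss hε hs.continuous (f.2.2 k) ha
  have e2 := integral_norm_le_of_gauss hε
    (f.2.1.continuous_iteratedDeriv (k + 1) (natCast_le_smooth _)) (f.2.2 (k + 1)) ha
  refine (add_le_add e1 e2).trans (le_of_eq ?_)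
  rw [← mul_add, mul_comm]
  rfl

/-! ### The standard Gaussian -/

/-- The Gaussian `e^(-x²)`, complex-valued. -/
noncomputable def gaussian (x : ℝ) : ℂ := Real.exp (-x ^ 2)

theorem gaussian_zero : gaussian 0 = 1 := by simp [gaussian]

theorem gaussian_neg (x : ℝ) : gaussian (-x) = gaussian x := by simp [gaussian]

theorem contDiff_gaussian : ContDiff ℝ ∞ gaussian :=
  Complex.ofRealCLM.contDiff.comp (by fun_prop : ContDiff ℝ ∞ fun x : ℝ => Real.exp (-x ^ 2))

theorem exists_iteratedDeriv_gaussian (k : ℕ) :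
    ∃ P : Polynomial ℝ,
      iteratedDeriv k gaussian = fun x => ((P.eval x * Real.exp (-x ^ 2) : ℝ) : ℂ) := by
  induction k with
  | zero => exact ⟨1, by funext x; simp [gaussian]⟩
  | succ k ih =>
    obtain ⟨P, hP⟩ := ih
    refine ⟨P.derivative - 2 * Polynomial.X * P, ?_⟩
    rw [iteratedDeriv_succ, hP]
    funext x
    have h : HasDerivAt (fun x : ℝ => P.eval x * Real.exp (-x ^ 2))
        (P.derivative.eval x * Real.exp (-x ^ 2) +
          P.eval x * (Real.exp (-x ^ 2) * (-(2 * x)))) x := by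
      refine (P.hasDerivAt x).mul ?_
      have := ((hasDerivAt_pow 2 x).neg).exp
      simpa using this
    rw [h.ofReal_comp.deriv]
    congr 1
    simp
    ring

theorem exists_polynomial_le (P : Polynomial ℝ) :
    ∃ (N : ℕ) (C : ℝ), 0 ≤ C ∧ ∀ x : ℝ, |P.eval x| ≤ C * (1 + |x|) ^ N := by
  refine ⟨P.natDegree, ∑ i ∈ Finset.range (P.natDegree + 1), |P.coeff i|, by positivity, ?_⟩
  intro x
  rw [Polynomial.eval_eq_sum_range, Finset.sum_mul]
  refine (Finset.abs_sum_le_sum_abs _ _).trans (Finset.sum_le_sum fun i hi => ?_)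
  rw [abs_mul, abs_pow]
  gcongr
  calc |x| ^ i ≤ (1 + |x|) ^ i := by gcongr; linarith
    _ ≤ (1 + |x|) ^ P.natDegree := pow_le_pow_right₀ (by linarith [abs_nonneg x])
        (Nat.lt_succ_iff.1 (Finset.mem_range.1 hi))

theorem exists_slotBound_gaussian (r : ℕ) : ∃ B, SlotBound true 2 r B gaussian := by
  have key : ∀ k, ∃ C : ℝ, 0 ≤ C ∧
      ∀ x, ‖iteratedDeriv k gaussian x‖ ≤ C * slotWeight true 2 k x := by
    intro k
    obtain ⟨P, hP⟩ := exists_iteratedDeriv_gaussian k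
    obtain ⟨N, C, hC, hCx⟩ := exists_polynomial_le P
    obtain ⟨D, hD, hDx⟩ := exists_gauss_mul_pow_le one_pos one_lt_two N
    refine ⟨C * D, by positivity, fun x => ?_⟩
    have h1 := hDx x
    rw [hP, Complex.norm_real, Real.norm_eq_abs, abs_mul, Real.abs_exp]
    simp only [Nat.cast_one, div_one] at h1
    calc |P.eval x| * Real.exp (-x ^ 2) ≤ C * (1 + |x|) ^ N * Real.exp (-x ^ 2) := by
          gcongr
          exact hCx x
      _ = C * (Real.exp (-x ^ 2) * (1 + |x|) ^ N) := by ring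
      _ ≤ C * (D * Real.exp (-(x ^ 2 / (2 : ℕ)))) := by gcongr
      _ = _ := by simp only [slotWeight]; ring
  choose C hC hCx using key
  refine ⟨∑ k ∈ Finset.range (r + 1), C k, contDiff_gaussian, fun k hk x => (hCx k x).trans ?_⟩
  refine mul_le_mul_of_nonneg_right ?_ (slotWeight_pos _ _ _ _).le
  exact Finset.single_le_sum (fun i _ => hC i) (Finset.mem_range.2 (Nat.lt_succ_of_le hk))

theorem exists_slotBound_id (r : ℕ) : ∃ B, SlotBound false 1 r B fun x : ℝ => (x : ℂ) := by
  refine ⟨1, Complex.ofRealCLM.contDiff, fun k _ x => ?_⟩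
  have h1 : deriv (fun x : ℝ => (x : ℂ)) = fun _ => 1 := by
    funext x
    exact (Complex.ofRealCLM.hasDerivAt (x := x)).deriv
  rw [one_mul]
  match k with
  | 0 => simp [slotWeight]
  | 1 => simp [h1, slotWeight]
  | k + 2 =>
    rw [iteratedDeriv_succ', h1, iteratedDeriv_const]
    simpa using (slotWeight_pos false 1 (k + 2) x).le

/-! ### Division by the coordinate -/

/-- The moments `∫₀¹ t^k u^(k+1)(t x) dt`, which are the derivatives of `(u(x) - u(0)) / x`. -/
noncomputable def quotDeriv (u : ℝ → ℂ) (k : ℕ) (x : ℝ) : ℂ :=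
  ∫ t in (0 : ℝ)..1, ((t ^ k : ℝ) : ℂ) * iteratedDeriv (k + 1) u (t * x)

section Quotient

variable {u : ℝ → ℂ}

theorem hasDerivAt_iteratedDeriv (hu : ContDiff ℝ ∞ u) (k : ℕ) (x : ℝ) :
    HasDerivAt (iteratedDeriv k u) (iteratedDeriv (k + 1) u x) x := by
  rw [iteratedDeriv_succ]
  exact (hu.differentiable_iteratedDeriv k
    (by exact_mod_cast WithTop.coe_lt_top k) x).hasDerivAt

theorem hasDerivAt_quotDeriv (hu : ContDiff ℝ ∞ u) (k : ℕ) (x : ℝ) :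
    HasDerivAt (quotDeriv u k) (quotDeriv u (k + 1) x) x := by
  have hc : ∀ j, Continuous (iteratedDeriv j u) := fun j =>
    hu.continuous_iteratedDeriv j (natCast_le_smooth j)
  have hc1 := hc (k + 1)
  have hc2 := hc (k + 2)
  obtain ⟨C, hC⟩ := (isCompact_Icc (a := -(|x| + 1)) (b := |x| + 1)).exists_bound_of_continuousOn
    hc2.continuousOn
  refine (intervalIntegral.hasDerivAt_integral_of_dominated_loc_of_deriv_le
    (F := fun y t => ((t ^ k : ℝ) : ℂ) * iteratedDeriv (k + 1) u (t * y))
    (F' := fun y t => ((t ^ (k + 1) : ℝ) : ℂ) * iteratedDeriv (k + 2) u (t * y))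
    (bound := fun _ => C) (Metric.ball_mem_nhds x one_pos)
    (Filter.Eventually.of_forall fun y => ?_) ?_ ?_ ?_ intervalIntegrable_const ?_).2
  · exact (Continuous.aestronglyMeasurable (by fun_prop))
  · exact Continuous.intervalIntegrable (by fun_prop) _ _
  · exact (Continuous.aestronglyMeasurable (by fun_prop))
  · refine Filter.Eventually.of_forall fun t ht y hy => ?_
    rw [Set.uIoc_of_le zero_le_one] at ht
    rw [Metric.mem_ball, Real.dist_eq] at hy
    have hy' : |y| ≤ |x| + 1 := by
      have := abs_sub_abs_le_abs_sub y x
      linarith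
    rw [norm_mul, Complex.norm_real, Real.norm_eq_abs, abs_of_nonneg (pow_nonneg ht.1.le _)]
    have h1 : |t * y| ≤ |x| + 1 := by
      rw [abs_mul, abs_of_pos ht.1]
      exact (mul_le_of_le_one_left (abs_nonneg y) ht.2).trans hy'
    exact (mul_le_of_le_one_left (norm_nonneg _) (pow_le_one₀ ht.1.le ht.2)).trans
      (hC _ (abs_le.1 h1))
  · refine Filter.Eventually.of_forall fun t _ y _ => ?_
    have h1 := (hasDerivAt_iteratedDeriv hu (k + 1) (t * y)).scomp y
      ((hasDerivAt_id y).const_mul t)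
    have h2 := h1.const_mul ((t ^ k : ℝ) : ℂ)
    refine h2.congr_deriv ?_
    rw [mul_one, Complex.real_smul]
    push_cast
    ring

theorem iteratedDeriv_quotDeriv (hu : ContDiff ℝ ∞ u) (k : ℕ) :
    iteratedDeriv k (quotDeriv u 0) = quotDeriv u k := by
  induction k with
  | zero => rfl
  | succ k ih =>
    rw [iteratedDeriv_succ, ih]
    funext x
    exact (hasDerivAt_quotDeriv hu k x).deriv

theorem contDiff_quotDeriv (hu : ContDiff ℝ ∞ u) : ContDiff ℝ ∞ (quotDeriv u 0) :=
  contDiff_of_differentiable_iteratedDeriv fun k _ => by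
    rw [iteratedDeriv_quotDeriv hu]
    exact fun x => (hasDerivAt_quotDeriv hu k x).differentiableAt

theorem mul_quotDeriv_zero (hu : ContDiff ℝ ∞ u) (x : ℝ) :
    (x : ℂ) * quotDeriv u 0 x = u x - u 0 := by
  have h : ∀ t ∈ Set.uIcc (0 : ℝ) 1, HasDerivAt (fun t : ℝ => u (t * x))
      ((x : ℂ) * iteratedDeriv 1 u (t * x)) t := fun t _ => by
    have h1 := (hasDerivAt_iteratedDeriv hu 0 (t * x)).scomp t ((hasDerivAt_id t).mul_const x)
    simpa [Function.comp_def] using h1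
  have hc : Continuous (iteratedDeriv 1 u) := hu.continuous_iteratedDeriv 1 (natCast_le_smooth 1)
  have := intervalIntegral.integral_eq_sub_of_hasDerivAt h
    (Continuous.intervalIntegrable (by fun_prop) _ _)
  rw [intervalIntegral.integral_const_mul] at this
  simpa [quotDeriv] using this

theorem mul_quotDeriv_succ (hu : ContDiff ℝ ∞ u) (k : ℕ) (x : ℝ) :
    (x : ℂ) * quotDeriv u (k + 1) x + (k + 1) * quotDeriv u k x = iteratedDeriv (k + 1) u x := by
  induction k generalizing x with
  | zero =>
    have h1 := (Complex.ofRealCLM.hasDerivAt (x := x)).mul (hasDerivAt_quotDeriv hu 0 x)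
    have h2 : HasDerivAt (fun x => u x - u 0) (iteratedDeriv 1 u x) x := by
      simpa using (hasDerivAt_iteratedDeriv hu 0 x).sub_const (u 0)
    have h3 : (fun x => u x - u 0) = (Complex.ofRealCLM : ℝ → ℂ) * quotDeriv u 0 := by
      funext y
      exact (mul_quotDeriv_zero hu y).symm
    rw [h3] at h2
    have := h1.unique h2
    simp only [Complex.ofRealCLM_apply, Complex.ofReal_one, one_mul] at this
    rw [← this]
    simp
    ring
  | succ k ih =>
    have h1 := ((Complex.ofRealCLM.hasDerivAt (x := x)).mul
      (hasDerivAt_quotDeriv hu (k + 1) x)).add ((hasDerivAt_quotDeriv hu k x).const_mul (k + 1 : ℂ))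
    have h2 := hasDerivAt_iteratedDeriv hu (k + 1) x
    have h3 : iteratedDeriv (k + 1) u = (Complex.ofRealCLM : ℝ → ℂ) * quotDeriv u (k + 1) +
        fun x => (k + 1 : ℂ) * quotDeriv u k x := by
      funext y
      exact (ih y).symm
    rw [h3] at h2
    have := h1.unique h2
    simp only [Complex.ofRealCLM_apply, Complex.ofReal_one, one_mul] at this
    rw [← this]
    push_cast
    ring

theorem norm_quotDeriv_le (k : ℕ) {x K : ℝ}
    (h : ∀ y, |y| ≤ |x| → ‖iteratedDeriv (k + 1) u y‖ ≤ K) : ‖quotDeriv u k x‖ ≤ K := by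
  have := intervalIntegral.norm_integral_le_of_norm_le_const (a := (0 : ℝ)) (b := 1) (C := K)
    (f := fun t => ((t ^ k : ℝ) : ℂ) * iteratedDeriv (k + 1) u (t * x)) fun t ht => by
      rw [Set.uIoc_of_le zero_le_one] at ht
      rw [norm_mul, Complex.norm_real, Real.norm_eq_abs, abs_of_nonneg (pow_nonneg ht.1.le _)]
      refine (mul_le_of_le_one_left (norm_nonneg _) (pow_le_one₀ ht.1.le ht.2)).trans (h _ ?_)
      rw [abs_mul, abs_of_pos ht.1]
      exact mul_le_of_le_one_left (abs_nonneg x) ht.2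
  simpa [quotDeriv] using this

end Quotient

theorem slotWeight_le_succ (d : Bool) (M k : ℕ) (x : ℝ) :
    slotWeight d M k x ≤ (1 + |x|) * slotWeight d M (k + 1) x := by
  cases d
  · refine le_of_eq ?_
    simp only [slotWeight]
    rw [← zpow_one_add₀ (by positivity)]
    congr 1
    push_cast
    ring
  · exact le_mul_of_one_le_left (Real.exp_pos _).le (by linarith [abs_nonneg x])

/-- Near the origin the derivatives of the quotient are controlled by one more derivative of `u`;
away from it, the recursion `x w^(k+1) + (k + 1) w^(k) = u^(k+1)` gains the decay of a symbol. -/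
theorem exists_quotDeriv_bound (d : Bool) (M k : ℕ) : ∃ C : ℝ, 0 ≤ C ∧ ∀ B u,
    SlotBound d M (k + 1) B u → u 0 = 0 →
      ∀ x, ‖quotDeriv u k x‖ ≤ C * B * slotWeight d M k x := by
  have near : ∀ k, ∃ K : ℝ, 0 ≤ K ∧ ∀ B u, SlotBound d M (k + 1) B u →
      ∀ x, |x| ≤ 1 → ‖quotDeriv u k x‖ ≤ K * B * slotWeight d M k x := by
    intro k
    obtain ⟨K₁, hK₁⟩ := (isCompact_Icc (a := (-1 : ℝ)) (b := 1)).exists_bound_of_continuousOn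
      (continuous_slotWeight d M (k + 1)).continuousOn
    obtain ⟨K₂, hK₂⟩ := (isCompact_Icc (a := (-1 : ℝ)) (b := 1)).exists_bound_of_continuousOn
      ((continuous_slotWeight d M k).inv₀ fun x => (slotWeight_pos d M k x).ne').continuousOn
    have h01 : (0 : ℝ) ∈ Set.Icc (-1 : ℝ) 1 := by simp
    have hK₁0 := (norm_nonneg _).trans (hK₁ 0 h01)
    have hK₂0 := (norm_nonneg _).trans (hK₂ 0 h01)
    refine ⟨K₁ * K₂, by positivity, fun B u hu x hx => ?_⟩
    have hB := hu.nonneg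
    have hw := slotWeight_pos d M k x
    have h1 : ‖quotDeriv u k x‖ ≤ B * K₁ := norm_quotDeriv_le k fun y hy => by
      refine (hu.bound (k + 1) le_rfl y).trans (mul_le_mul_of_nonneg_left ?_ hB)
      exact (Real.le_norm_self _).trans (hK₁ y (abs_le.1 (hy.trans hx)))
    have h2 := (Real.le_norm_self _).trans (hK₂ x (abs_le.1 hx))
    have h3 : 1 ≤ K₂ * slotWeight d M k x := by
      rwa [Pi.inv_apply, inv_le_iff_one_le_mul₀ hw] at h2
    calc ‖quotDeriv u k x‖ ≤ B * K₁ * 1 := by rw [mul_one]; exact h1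
      _ ≤ B * K₁ * (K₂ * slotWeight d M k x) := by gcongr
      _ = _ := by ring
  induction k with
  | zero =>
    obtain ⟨K, hK, h⟩ := near 0
    refine ⟨K + 1, by positivity, fun B u hu hu0 x => ?_⟩
    have hB := hu.nonneg
    have hw := slotWeight_pos d M 0 x
    rcases le_total |x| 1 with hx | hx
    · exact (h B u hu x hx).trans (by gcongr; linarith)
    · have h1 : |x| * ‖quotDeriv u 0 x‖ = ‖u x‖ := by
        have := mul_quotDeriv_zero hu.smooth x
        rw [hu0, sub_zero] at this
        rw [← this, norm_mul, Complex.norm_real, Real.norm_eq_abs]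
      have h2 : ‖u x‖ ≤ B * slotWeight d M 0 x := by
        simpa using hu.bound 0 (Nat.zero_le _) x
      have h3 := le_mul_of_one_le_left (norm_nonneg (quotDeriv u 0 x)) hx
      have h4 : 0 ≤ K * B * slotWeight d M 0 x := by positivity
      linarith
  | succ k ih =>
    obtain ⟨K, hK, h⟩ := near (k + 1)
    obtain ⟨C, hC, h'⟩ := ih
    refine ⟨K + 2 * (1 + (k + 1) * C), by positivity, fun B u hu hu0 x => ?_⟩
    have hB := hu.nonneg
    have hw := slotWeight_pos d M (k + 1) x
    rcases le_total |x| 1 with hx | hx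
    · refine (h B u hu x hx).trans ?_
      gcongr
      have : 0 ≤ 2 * (1 + (k + 1) * C) := by positivity
      linarith
    · have h1 : |x| * ‖quotDeriv u (k + 1) x‖ ≤
          ‖iteratedDeriv (k + 1) u x‖ + (k + 1) * ‖quotDeriv u k x‖ := by
        have h2 := mul_quotDeriv_succ hu.smooth k x
        have h3 : |x| * ‖quotDeriv u (k + 1) x‖ = ‖(x : ℂ) * quotDeriv u (k + 1) x‖ := by
          rw [norm_mul, Complex.norm_real, Real.norm_eq_abs]
        rw [h3, eq_sub_of_add_eq h2]
        refine (norm_sub_le _ _).trans (le_of_eq ?_)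
        rw [norm_mul]
        norm_cast
      have h4 := hu.bound (k + 1) (Nat.le_succ _) x
      have h5 := h' B u ⟨hu.smooth, fun j hj => hu.bound j (hj.trans (Nat.le_succ _))⟩ hu0 x
      have h6 := slotWeight_le_succ d M k x
      set W := slotWeight d M (k + 1) x
      have h7 : (1 + |x|) * ‖quotDeriv u (k + 1) x‖ ≤
          (1 + |x|) * (2 * (1 + (k + 1) * C) * B * W) := by
        have h8 : ‖quotDeriv u k x‖ ≤ C * B * ((1 + |x|) * W) := h5.trans (by gcongr)
        have h9 : B * W ≤ (1 + |x|) * (B * W) :=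
          le_mul_of_one_le_left (by positivity) (by linarith)
        have h10 : (k + 1 : ℝ) * ‖quotDeriv u k x‖ ≤ (k + 1) * (C * B * ((1 + |x|) * W)) := by
          gcongr
        have h11 := mul_le_mul_of_nonneg_right hx (norm_nonneg (quotDeriv u (k + 1) x))
        nlinarith
      have h12 := le_of_mul_le_mul_left h7 (by positivity)
      refine h12.trans ?_
      gcongr
      linarith

/-- Division by the coordinate after subtraction of the value at the origin, uniformly in the
bounds and without leaving the type of slot. -/
theorem exists_slotBound_div (d : Bool) {M : ℕ} (hM : 0 < M) (r : ℕ) : ∃ C : ℝ, 0 ≤ C ∧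
    ∀ B v, SlotBound d M (r + 1) B v →
      SlotBound d (M + 2) r (C * B) (quotDeriv (fun x => v x - gaussian x * v 0) 0) := by
  obtain ⟨G, hG⟩ := exists_slotBound_gaussian (r + 1)
  have hG0 := hG.nonneg
  obtain ⟨D, hD, hDw⟩ := exists_slotWeight_true_le_false (Nat.succ_pos (M + 1)) (r + 1)
  have hu : ∀ B v, SlotBound d M (r + 1) B v → SlotBound d (M + 2) (r + 1) ((1 + G * (1 + D)) * B)
      fun x => v x - gaussian x * v 0 := by
    intro B v hv
    have hB := hv.nonneg
    refine ⟨hv.smooth.sub (contDiff_gaussian.mul contDiff_const), fun k hk x => ?_⟩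
    have hk' := natCast_le_smooth k
    have e1 : iteratedDeriv k (fun x => v x - gaussian x * v 0) x =
        iteratedDeriv k v x - v 0 * iteratedDeriv k gaussian x := by
      have e2 : (fun x => v x - gaussian x * v 0) = v - v 0 • gaussian := by
        funext y
        simp [mul_comm]
      rw [e2, iteratedDeriv_sub (hv.smooth.contDiffAt.of_le hk')
        (g := v 0 • gaussian) ((contDiff_gaussian.const_smul (v 0)).contDiffAt.of_le hk'),
        iteratedDeriv_const_smul (contDiff_gaussian.contDiffAt.of_le hk'), smul_eq_mul]
    have h1 := (hv.mono_order hM (Nat.le_add_right M 2)).bound k hk x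
    have h2 := (hG.mono_order two_pos (Nat.le_add_left 2 M)).bound k hk x
    have h3 : slotWeight true (M + 2) k x ≤ (1 + D) * slotWeight d (M + 2) k x := by
      have hw := slotWeight_pos d (M + 2) k x
      cases d
      · exact (hDw k hk x).trans (by gcongr; linarith)
      · exact le_mul_of_one_le_left hw.le (by linarith)
    rw [e1]
    refine (norm_sub_le _ _).trans ?_
    rw [norm_mul]
    calc ‖iteratedDeriv k v x‖ + ‖v 0‖ * ‖iteratedDeriv k gaussian x‖
        ≤ B * slotWeight d (M + 2) k x + B * (G * ((1 + D) * slotWeight d (M + 2) k x)) := by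
          gcongr
          · exact hv.norm_zero_le
          · exact h2.trans (by gcongr)
      _ = _ := by ring
  choose C hC hCb using fun k => exists_quotDeriv_bound d (M + 2) k
  refine ⟨(∑ k ∈ Finset.range (r + 1), C k) * (1 + G * (1 + D)),
    mul_nonneg (Finset.sum_nonneg fun k _ => hC k) (by positivity), fun B v hv => ?_⟩
  have huv := hu B v hv
  refine ⟨contDiff_quotDeriv huv.smooth, fun k hk x => ?_⟩
  rw [iteratedDeriv_quotDeriv huv.smooth]
  refine (hCb k _ _ ⟨huv.smooth, fun j hj => huv.bound j (by omega)⟩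
    (by simp [gaussian_zero]) x).trans ?_
  have h1 := Finset.single_le_sum (fun i _ => hC i) (Finset.mem_range.2 (Nat.lt_succ_of_le hk))
  have h2 := huv.nonneg
  have h3 := slotWeight_pos d (M + 2) k x
  rw [mul_assoc (∑ k ∈ Finset.range (r + 1), C k)]
  gcongr

theorem div_spec {d : Bool} {M r : ℕ} {B : ℝ} {v : ℝ → ℂ} (hv : SlotBound d M r B v) (x : ℝ) :
    v x = (x : ℂ) * quotDeriv (fun x => v x - gaussian x * v 0) 0 x + gaussian x * v 0 := by
  rw [mul_quotDeriv_zero (hv.smooth.sub (contDiff_gaussian.mul contDiff_const))]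
  simp [gaussian_zero]

/-! ### The defining seminorms and the pointwise bounds -/

theorem slotSeminorm_mono (d : Bool) (m : ℕ) : Monotone (slotSeminorm d m) := by
  intro r s hrs
  cases d <;>
  exact Finset.sup_mono (Finset.range_mono (Nat.succ_le_succ hrs))

/-- Elements of a slot satisfy the pointwise bounds, with constants given by the seminorms. -/
theorem slotBound_of_mem (d : Bool) {m M : ℕ} (hm : d = true → 0 < m) (hM : 0 < M)
    (hmM : 2 * m ≤ M) (r : ℕ) (v : slotSpace d m) :
    SlotBound d M r (2 * slotSeminorm d m (r + 1) v) v := by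
  cases d
  · change symbolSpace m at v
    refine ⟨v.2.1, fun k hk x => ?_⟩
    have h1 : symbolSeminorm m k v ≤ slotSeminorm false m (r + 1) v :=
      Seminorm.le_def.1 (Finset.le_sup (f := symbolSeminorm m)
        (Finset.mem_range.2 (by omega : k < r + 1 + 1))) v
    have h2 := le_ciSup (symbolSpace_bdd k v) x
    have h3 : ‖iteratedDeriv k (v : ℝ → ℂ) x‖ ≤ symbolSeminorm m k v * slotWeight false m k x := by
      have h4 : 0 < (1 + |x|) ^ ((m : ℤ) - k) := by positivity
      refine le_trans (le_of_eq ?_) (mul_le_mul_of_nonneg_right h2 h4.le)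
      simp only [slotWeight]
      rw [mul_assoc, ← zpow_add₀ (by positivity)]
      simp
    have h5 : slotWeight false m k x ≤ slotWeight false M k x :=
      zpow_le_zpow_right₀ (by linarith [abs_nonneg x]) (by omega)
    have h6 : 0 ≤ symbolSeminorm m k v := apply_nonneg _ _
    have h7 := slotWeight_pos false M k x
    calc _ ≤ symbolSeminorm m k v * slotWeight false m k x := h3
      _ ≤ (2 * slotSeminorm false m (r + 1) v) * slotWeight false M k x := by
        refine mul_le_mul (by linarith) h5 (slotWeight_pos _ _ _ _).le (by linarith)
  · change expDecaySpace (1 / (m : ℝ)) at v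
    have hm0 : (0 : ℝ) < m := by exact_mod_cast hm rfl
    refine ⟨v.2.1, fun k hk x => ?_⟩
    have h1 : ∀ j, j < r + 1 + 1 → expDecaySeminorm (1 / (m : ℝ)) j v ≤
        slotSeminorm true m (r + 1) v := fun j hj =>
      Seminorm.le_def.1 (Finset.le_sup (f := expDecaySeminorm (1 / (m : ℝ)))
        (Finset.mem_range.2 hj)) v
    refine (norm_iteratedDeriv_le_of_expDecay (by positivity) v k x).trans ?_
    have h2 : Real.exp (-(1 / (m : ℝ) * x ^ 2 / 2)) ≤ slotWeight true M k x := by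
      have h3 : (2 * m : ℝ) ≤ M := by exact_mod_cast hmM
      have h4 : 1 / (m : ℝ) * x ^ 2 / 2 = x ^ 2 / (2 * m) := by field_simp
      rw [h4]
      simp only [slotWeight]
      gcongr
    have h5 := h1 k (by omega)
    have h6 := h1 (k + 1) (by omega)
    have h7 : 0 ≤ expDecaySeminorm (1 / (m : ℝ)) k v := apply_nonneg _ _
    have h8 : 0 ≤ expDecaySeminorm (1 / (m : ℝ)) (k + 1) v := apply_nonneg _ _
    exact mul_le_mul (by linarith) h2 (Real.exp_pos _).le (by linarith)

theorem exp_mul_norm_sq_le {M r : ℕ} {B : ℝ} {g : ℝ → ℂ} (h : SlotBound true M r B g)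
    {k : ℕ} (hk : k ≤ r) (x : ℝ) :
    Real.exp (1 / (M : ℝ) * x ^ 2) * ‖iteratedDeriv k g x‖ ^ 2 ≤
      B ^ 2 * Real.exp (-(1 / (M : ℝ)) * x ^ 2) := by
  calc Real.exp (1 / (M : ℝ) * x ^ 2) * ‖iteratedDeriv k g x‖ ^ 2
      ≤ Real.exp (1 / (M : ℝ) * x ^ 2) * (B * Real.exp (-(x ^ 2 / M))) ^ 2 := by
        gcongr
        exact h.bound k hk x
    _ = B ^ 2 * Real.exp (-(1 / (M : ℝ)) * x ^ 2) := by
        rw [mul_pow, ← Real.exp_nat_mul, mul_left_comm, ← Real.exp_add]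
        congr 2
        push_cast
        ring

theorem integrable_of_slotBound {M r : ℕ} (hM : 0 < M) {B : ℝ} {g : ℝ → ℂ}
    (h : SlotBound true M r B g) {k : ℕ} (hk : k ≤ r) :
    MeasureTheory.Integrable
      fun x : ℝ => Real.exp (1 / (M : ℝ) * x ^ 2) * ‖iteratedDeriv k g x‖ ^ 2 := by
  have hc := h.smooth.continuous_iteratedDeriv k (natCast_le_smooth k)
  refine ((integrable_exp_neg_mul_sq (by positivity : 0 < 1 / (M : ℝ))).const_mul (B ^ 2)).mono'
    (Continuous.aestronglyMeasurable (by fun_prop)) (Filter.Eventually.of_forall fun x => ?_)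
  rw [Real.norm_of_nonneg (by positivity)]
  exact exp_mul_norm_sq_le h hk x

theorem mem_slotSpace (d : Bool) {M : ℕ} (hM : 0 < M) {g : ℝ → ℂ}
    (h : ∀ r, ∃ B, SlotBound d M r B g) : g ∈ slotSpace d M := by
  obtain ⟨_, h0⟩ := h 0
  cases d
  · refine ⟨h0.smooth, fun k => ?_⟩
    obtain ⟨B, hB⟩ := h k
    exact ⟨B, hB.bound k le_rfl⟩
  · refine ⟨h0.smooth, fun k => ?_⟩
    obtain ⟨B, hB⟩ := h k
    exact integrable_of_slotBound hM hB le_rfl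

/-- The seminorms of a slot are controlled by the constants in the pointwise bounds. -/
theorem exists_slotSeminorm_le (d : Bool) {M : ℕ} (hM : 0 < M) (r : ℕ) : ∃ C : ℝ, 0 ≤ C ∧
    ∀ B (v : slotSpace d M), SlotBound d M r B v → slotSeminorm d M r v ≤ C * B := by
  cases d
  · refine ⟨1, zero_le_one, fun B v hv => ?_⟩
    change symbolSpace M at v
    rw [one_mul]
    refine Seminorm.finset_sup_apply_le hv.nonneg fun k hk => ciSup_le fun x => ?_
    have h1 := hv.bound k (Nat.lt_succ_iff.1 (Finset.mem_range.1 hk)) x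
    have h4 : 0 < (1 + |x|) ^ ((k : ℤ) - M) := by positivity
    refine (mul_le_mul_of_nonneg_right h1 h4.le).trans (le_of_eq ?_)
    simp only [slotWeight]
    rw [mul_assoc, ← zpow_add₀ (by positivity)]
    simp
  · refine ⟨√(∫ x : ℝ, Real.exp (-(1 / (M : ℝ)) * x ^ 2)), Real.sqrt_nonneg _, fun B v hv => ?_⟩
    change expDecaySpace (1 / (M : ℝ)) at v
    refine Seminorm.finset_sup_apply_le (mul_nonneg (Real.sqrt_nonneg _) hv.nonneg) fun k hk => ?_
    have hk' := Nat.lt_succ_iff.1 (Finset.mem_range.1 hk)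
    have hM0 : 0 < 1 / (M : ℝ) := by positivity
    change √(∫ x : ℝ, Real.exp (1 / (M : ℝ) * x ^ 2) * ‖iteratedDeriv k (v : ℝ → ℂ) x‖ ^ 2) ≤ _
    rw [mul_comm, ← Real.sqrt_sq hv.nonneg, ← Real.sqrt_mul (sq_nonneg B),
      ← MeasureTheory.integral_const_mul]
    exact Real.sqrt_le_sqrt (MeasureTheory.integral_mono (integrable_of_slotBound hM hv hk')
      ((integrable_exp_neg_mul_sq hM0).const_mul _) fun x => exp_mul_norm_sq_le hv hk' x)

/-! ### Series of elementary tensors with pointwise bounds -/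

/-- The function `f` of `N` variables is the sum of a series `∑ c_i ∏_j v_ij(x_j)` which converges
absolutely for all bounds on derivatives of `v_ij`.  The slots with `d j` true are Gaussian, the
others consist of symbols, and one order `M` serves all slots. -/
def IsSlotSeries {N : ℕ} (d : Fin N → Bool) (M : ℕ) (f : (Fin N → ℝ) → ℂ) : Prop :=
  ∃ (c : ℕ → ℂ) (v : ℕ → Fin N → ℝ → ℂ) (B : ℕ → ℕ → Fin N → ℝ),
    (∀ r i j, SlotBound (d j) M r (B r i j) (v i j)) ∧
    (∀ r, Summable fun i => ‖c i‖ * ∏ j, B r i j) ∧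
    ∀ x, HasSum (fun i => c i * ∏ j, v i j (x j)) (f x)

theorem norm_term_le {N : ℕ} {d : Fin N → Bool} {M : ℕ} {c : ℂ} {v : Fin N → ℝ → ℂ}
    {B : Fin N → ℝ} {r : ℕ} (h : ∀ j, SlotBound (d j) M r (B j) (v j)) (x : Fin N → ℝ) :
    ‖c * ∏ j, v j (x j)‖ ≤ (∏ j, slotWeight (d j) M 0 (x j)) * (‖c‖ * ∏ j, B j) := by
  rw [norm_mul, norm_prod, mul_left_comm, ← Finset.prod_mul_distrib]
  refine mul_le_mul_of_nonneg_left (Finset.prod_le_prod (fun j _ => norm_nonneg _) fun j _ => ?_)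
    (norm_nonneg _)
  simpa [mul_comm] using (h j).bound 0 (Nat.zero_le _) (x j)

theorem IsSlotSeries.continuous {N : ℕ} {d : Fin N → Bool} {M : ℕ} {f : (Fin N → ℝ) → ℂ}
    (hf : IsSlotSeries d M f) : Continuous f := by
  obtain ⟨c, v, B, hB, hs, hsum⟩ := hf
  have hW : Continuous fun x : Fin N → ℝ => ∏ j, slotWeight (d j) M 0 (x j) :=
    continuous_finsetProd _ fun j _ => (continuous_slotWeight _ _ _).comp (continuous_apply j)
  have hv : ∀ i j, Continuous (v i j) := fun i j => (hB 0 i j).smooth.continuous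
  have e : f = fun x => ∑' i, c i * ∏ j, v i j (x j) := funext fun x => (hsum x).tsum_eq.symm
  rw [continuous_iff_continuousAt]
  intro x
  -- on a neighbourhood where the weights are bounded the series converges uniformly
  set K := ∏ j, slotWeight (d j) M 0 (x j)
  have hopen : IsOpen {y : Fin N → ℝ | ∏ j, slotWeight (d j) M 0 (y j) < K + 1} :=
    isOpen_lt hW continuous_const
  have hcont : ContinuousOn f {y : Fin N → ℝ | ∏ j, slotWeight (d j) M 0 (y j) < K + 1} := by
    rw [e]
    refine continuousOn_tsum (u := fun i => (K + 1) * (‖c i‖ * ∏ j, B 0 i j))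
      (fun i => Continuous.continuousOn (by fun_prop)) ((hs 0).mul_left _) fun i y hy => ?_
    refine (norm_term_le (hB 0 i) y).trans (mul_le_mul_of_nonneg_right (le_of_lt hy) ?_)
    exact mul_nonneg (norm_nonneg _) (Finset.prod_nonneg fun j _ => (hB 0 i j).nonneg)
  exact hcont.continuousAt (hopen.mem_nhds (lt_add_one K))

theorem isSlotSeries_of_mem_FkSpace {n : ℕ} {k : Fin (n + 1)} {m : Fin (n + 1) → ℕ} (hm : 0 < m k)
    {f : (Fin (n + 1) → ℝ) → ℂ} (hf : f ∈ FkSpace n k m) :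
    ∃ M, 0 < M ∧ IsSlotSeries (fun j => decide (j = k)) M f := by
  have hd : ∀ j, decide (j = k) = true → 0 < m j := fun j hj => by
    rw [decide_eq_true_eq] at hj
    rwa [hj]
  set M := 2 * ∑ j, m j + 1
  have hM : 0 < M := Nat.succ_pos _
  have hmM : ∀ j, 2 * m j ≤ M := fun j => by
    have := Finset.single_le_sum (f := m) (fun _ _ => Nat.zero_le _) (Finset.mem_univ j)
    omega
  rw [FkSpace, mem_completedTensorImage_iff _ _ (fun j => slotSeminorm_mono _ _) 1 ?_] at hf
  · obtain ⟨c, v, hs, hsum⟩ := hf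
    refine ⟨M, hM, c, fun i j => v i j,
      fun r i j => 2 * slotSeminorm (decide (j = k)) (m j) (r + 1) (v i j),
      fun r i j => slotBound_of_mem _ (hd j) hM (hmM j) r _, fun r => ?_, hsum⟩
    refine ((hs (r + 1)).mul_left (2 ^ (n + 1))).congr fun i => ?_
    rw [Finset.prod_mul_distrib]
    simp only [Finset.prod_const, Finset.card_univ, Fintype.card_fin]
    ring
  · intro j y
    refine ⟨2 * slotWeight (decide (j = k)) M 0 y, fun v => ?_⟩
    have := (slotBound_of_mem _ (hd j) hM (hmM j) 0 v).bound 0 le_rfl y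
    rw [iteratedDeriv_zero] at this
    refine this.trans (le_of_eq ?_)
    ring

theorem IsSlotSeries.mem_FSpace {n : ℕ} {d : Fin (n + 1) → Bool} {M : ℕ} (hM : 0 < M)
    {f : (Fin (n + 1) → ℝ) → ℂ} (hf : IsSlotSeries d M f) {k : Fin (n + 1)} (hk : d k = true) :
    f ∈ FSpace n := by
  refine Submodule.mem_iSup_of_mem k (Submodule.mem_iSup_of_mem (fun _ => M)
    (Submodule.mem_iSup_of_mem hM ?_))
  obtain ⟨c, v, B, hB, hs, hsum⟩ := hf
  choose D hD hDw using fun r => exists_slotWeight_true_le_false hM r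
  -- the Gaussian slots other than `k` are regarded as symbol slots
  have hB' : ∀ r i j, SlotBound (decide (j = k)) M r ((1 + D r) * B r i j) (v i j) := by
    intro r i j
    have hb := hB r i j
    have hb0 := hb.nonneg
    have hD0 := hD r
    by_cases hjk : j = k
    · subst hjk
      rw [decide_eq_true rfl, ← hk]
      exact hb.mono_const (le_mul_of_one_le_left hb0 (by linarith))
    · rw [decide_eq_false hjk]
      cases hdj : d j
      · rw [hdj] at hb
        exact hb.mono_const (le_mul_of_one_le_left hb0 (by linarith))
      · rw [hdj] at hb
        refine ⟨hb.smooth, fun l hl x => (hb.bound l hl x).trans ?_⟩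
        have hw := slotWeight_pos false M l x
        calc B r i j * slotWeight true M l x
            ≤ B r i j * (D r * slotWeight false M l x) := by
              gcongr
              exact hDw r l hl x
          _ ≤ B r i j * ((1 + D r) * slotWeight false M l x) := by gcongr; linarith
          _ = _ := by ring
  have hmem : ∀ i j, v i j ∈ slotSpace (decide (j = k)) M := fun i j =>
    mem_slotSpace _ hM fun r => ⟨_, hB' r i j⟩
  choose C hC hCs using fun r (j : Fin (n + 1)) => exists_slotSeminorm_le (decide (j = k)) hM r
  rw [FkSpace, mem_completedTensorImage_iff _ _ (fun j => slotSeminorm_mono _ _) 1 ?_]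
  · refine ⟨c, fun i j => ⟨v i j, hmem i j⟩, fun r => ?_, hsum⟩
    refine Summable.of_nonneg_of_le (fun i => mul_nonneg (norm_nonneg _)
      (Finset.prod_nonneg fun j _ => apply_nonneg _ _)) (fun i => ?_)
      ((hs r).mul_left (∏ j, C r j * (1 + D r)))
    rw [mul_left_comm, ← Finset.prod_mul_distrib]
    refine mul_le_mul_of_nonneg_left (Finset.prod_le_prod (fun j _ => apply_nonneg _ _)
      fun j _ => ?_) (norm_nonneg _)
    rw [mul_assoc]
    exact hCs r j _ ⟨v i j, hmem i j⟩ (hB' r i j)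
  · intro j y
    refine ⟨2 * slotWeight (decide (j = k)) (2 * M) 0 y, fun w => ?_⟩
    have := (slotBound_of_mem (decide (j = k)) (fun _ => hM) (by omega : 0 < 2 * M) le_rfl 0
      w).bound 0 le_rfl y
    rw [iteratedDeriv_zero] at this
    refine this.trans (le_of_eq ?_)
    ring

/-- To show that `𝓕^(n)` lies in a subspace it suffices to consider series with one Gaussian
slot. -/
theorem FSpace_le {n : ℕ} {S : Submodule ℂ ((Fin (n + 1) → ℝ) → ℂ)}
    (h : ∀ (k : Fin (n + 1)) (M : ℕ) (f : (Fin (n + 1) → ℝ) → ℂ), 0 < M →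
      IsSlotSeries (fun j => decide (j = k)) M f → f ∈ S) : FSpace n ≤ S :=
  iSup_le fun k => iSup_le fun _ => iSup_le fun hm f hf => by
    obtain ⟨M, hM, hf'⟩ := isSlotSeries_of_mem_FkSpace hm hf
    exact h k M f hM hf'

theorem continuous_of_mem_FSpace {n : ℕ} {f : (Fin (n + 1) → ℝ) → ℂ} (hf : f ∈ FSpace n) :
    Continuous f := by
  let S : Submodule ℂ ((Fin (n + 1) → ℝ) → ℂ) :=
    { carrier := {f | Continuous f}
      add_mem' := fun hf hg => Continuous.add hf hg
      zero_mem' := continuous_const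
      smul_mem' := fun c f hf => Continuous.const_smul hf c }
  exact FSpace_le (S := S) (fun k M f _ hf => hf.continuous) hf

/-! ### Operations on `𝓕^(n)` -/

/-- The substitution operators `f ↦ (y ↦ ∏ c_k(y_k) · f(ε_j y_(σ j))_j)`.  Faces, degeneracies,
restrictions to `x_j = 0`, and multiplications by functions of one variable are of this form. -/
def substMap {n n' : ℕ} (c : Fin (n' + 1) → ℝ → ℂ) (σ : Fin (n + 1) → Fin (n' + 1))
    (ε : Fin (n + 1) → ℝ) : ((Fin (n + 1) → ℝ) → ℂ) →ₗ[ℂ] ((Fin (n' + 1) → ℝ) → ℂ) where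
  toFun f y := (∏ k, c k (y k)) * f fun j => ε j * y (σ j)
  map_add' f g := by
    funext y
    simp [mul_add]
  map_smul' a f := by
    funext y
    simp [mul_left_comm]

theorem SlotBound.comp_mul {d : Bool} {M r : ℕ} {B : ℝ} {g : ℝ → ℂ} (h : SlotBound d M r B g)
    (hM : 0 < M) {ε : ℝ} (hε : ε = 1 ∨ ε = -1 ∨ ε = 0) :
    SlotBound (d && decide (ε ≠ 0)) M r B fun y => g (ε * y) := by
  rcases hε with rfl | rfl | rfl
  · simpa using h
  · simpa using h.comp_neg
  · simpa using (SlotBound.const hM r (g 0)).mono_const h.norm_zero_le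

theorem IsSlotSeries.subst {n n' : ℕ} {d : Fin (n + 1) → Bool} {M : ℕ} (hM : 0 < M)
    {f : (Fin (n + 1) → ℝ) → ℂ} (hf : IsSlotSeries d M f) {c : Fin (n' + 1) → ℝ → ℂ}
    {σ : Fin (n + 1) → Fin (n' + 1)} {ε : Fin (n + 1) → ℝ}
    (hε : ∀ j, ε j = 1 ∨ ε j = -1 ∨ ε j = 0) {e : Fin (n' + 1) → Bool} {M' : ℕ} (hM' : 0 < M')
    (hc : ∀ k r, ∃ K, SlotBound (e k) M' r K (c k)) :
    IsSlotSeries (fun k => e k ||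
      (Finset.univ.filter fun j => σ j = k).sup fun j => d j && decide (ε j ≠ 0))
      (M' + (n + 2) * M) (substMap c σ ε f) := by
  obtain ⟨a, v, B, hB, hs, hsum⟩ := hf
  choose K hK using hc
  let s : Fin (n' + 1) → Finset (Fin (n + 1)) := fun k => Finset.univ.filter fun j => σ j = k
  choose C hC hCb using fun r k =>
    exists_slotBound_prod (s k) (fun j => d j && decide (ε j ≠ 0)) hM r
  choose D hD hDb using fun r k => exists_slotBound_mul hM' (M₂ := ((s k).card + 1) * M)
    (by positivity) (e k) ((s k).sup fun j => d j && decide (ε j ≠ 0)) r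
  have hfib : ∀ {R : Type} [CommMonoid R] (w : Fin (n + 1) → R),
      ∏ k, ∏ j ∈ s k, w j = ∏ j, w j := fun w =>
    Finset.prod_fiberwise (s := Finset.univ) (g := σ) (f := w)
  refine ⟨a, fun i k y => c k y * ∏ j ∈ s k, v i j (ε j * y),
    fun r i k => D r k * (K k r * (C r k * ∏ j ∈ s k, B r i j)), fun r i k => ?_, fun r => ?_,
    fun y => ?_⟩
  · refine SlotBound.mono_order (hDb r k _ _ _ _ (hK k r) (hCb r k (B r i) _ fun j =>
      (hB r i j).comp_mul hM (hε j))) (by positivity) ?_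
    have h1 : (s k).card ≤ n + 1 := (Finset.card_le_univ _).trans (by simp)
    exact Nat.add_le_add_left (Nat.mul_le_mul_right M (Nat.add_le_add_right h1 1)) M'
  · refine ((hs r).mul_left (∏ k, D r k * K k r * C r k)).congr fun i => ?_
    rw [← hfib (B r i), mul_left_comm, ← Finset.prod_mul_distrib]
    congr 1
    exact Finset.prod_congr rfl fun k _ => by ring
  · have h1 := (hsum fun j => ε j * y (σ j)).mul_left (∏ k, c k (y k))
    refine h1.congr_fun fun i => Eq.symm ?_
    rw [Finset.prod_mul_distrib, mul_left_comm, ← hfib]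
    congr 2
    refine Finset.prod_congr rfl fun k _ => Finset.prod_congr rfl fun j hj => ?_
    rw [(Finset.mem_filter.1 hj).2]

/-- A substitution operator preserves the spaces `𝓕`, provided it does not destroy the Gaussian
decay by restricting to `0`, or creates new Gaussian decay. -/
theorem substMap_mem {n n' : ℕ} {f : (Fin (n + 1) → ℝ) → ℂ} (hf : f ∈ FSpace n)
    {c : Fin (n' + 1) → ℝ → ℂ} {σ : Fin (n + 1) → Fin (n' + 1)} {ε : Fin (n + 1) → ℝ}
    (hε : ∀ j, ε j = 1 ∨ ε j = -1 ∨ ε j = 0) {e : Fin (n' + 1) → Bool} {M' : ℕ} (hM' : 0 < M')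
    (hc : ∀ k r, ∃ K, SlotBound (e k) M' r K (c k)) (h : (∃ k, e k = true) ∨ ∀ j, ε j ≠ 0) :
    substMap c σ ε f ∈ FSpace n' := by
  refine FSpace_le (S := (FSpace n').comap (substMap c σ ε)) (fun k M f hM hf => ?_) hf
  have h1 := hf.subst (σ := σ) hM hε hM' hc
  have hpos : 0 < M' + (n + 2) * M := by positivity
  rcases h with ⟨l, hl⟩ | h
  · exact h1.mem_FSpace hpos (k := l) (by simp [hl])
  · refine h1.mem_FSpace hpos (k := σ k) ?_
    rw [Bool.or_eq_true]
    refine Or.inr (top_le_iff.1 (le_trans (le_of_eq ?_) (Finset.le_sup (b := k) (by simp))))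
    simp [h k]

/-- Elements of `𝓕^(n)` can be divided by a coordinate within `𝓕^(n)`, up to the restriction to
the hyperplane where this coordinate vanishes. -/
theorem exists_div_coord {n : ℕ} {f : (Fin (n + 1) → ℝ) → ℂ} (hf : f ∈ FSpace n)
    (l : Fin (n + 1)) : ∃ g ∈ FSpace n, ∀ x,
      f x = (x l : ℂ) * g x + gaussian (x l) * f (Function.update x l 0) := by
  let S : Submodule ℂ ((Fin (n + 1) → ℝ) → ℂ) :=
    { carrier := {f | ∃ g ∈ FSpace n, ∀ x,
        f x = (x l : ℂ) * g x + gaussian (x l) * f (Function.update x l 0)}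
      add_mem' := by
        rintro f f' ⟨g, hg, h⟩ ⟨g', hg', h'⟩
        refine ⟨g + g', add_mem hg hg', fun x => ?_⟩
        simp only [Pi.add_apply]
        rw [h x, h' x]
        ring
      zero_mem' := ⟨0, zero_mem _, fun x => by simp⟩
      smul_mem' := by
        rintro a f ⟨g, hg, h⟩
        refine ⟨a • g, Submodule.smul_mem _ a hg, fun x => ?_⟩
        simp only [Pi.smul_apply, smul_eq_mul]
        rw [h x]
        ring }
  refine FSpace_le (S := S) (fun k M f hM hf => ?_) hf
  obtain ⟨a, v, B, hB, hs, hsum⟩ := hf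
  let w : ℕ → ℝ → ℂ := fun i => quotDeriv (fun x => v i l x - gaussian x * v i l 0) 0
  choose C hC hCb using fun r => exists_slotBound_div (decide (l = k)) hM r
  let v' : ℕ → Fin (n + 1) → ℝ → ℂ := fun i => Function.update (v i) l (w i)
  let B' : ℕ → ℕ → Fin (n + 1) → ℝ := fun r i =>
    Function.update (B (r + 1) i) l (C r * B (r + 1) i l)
  have hB' : ∀ r i j, SlotBound (decide (j = k)) (M + 2) r (B' r i j) (v' i j) := by
    intro r i j
    by_cases hj : j = l
    · subst hj
      simpa [v', B'] using hCb r _ _ (hB (r + 1) i j)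
    · simp only [v', B', Function.update_of_ne hj]
      have h1 := (hB (r + 1) i j).mono_order hM (Nat.le_add_right M 2)
      exact ⟨h1.smooth, fun q hq x => h1.bound q (hq.trans (Nat.le_succ r)) x⟩
  have hs' : ∀ r, Summable fun i => ‖a i‖ * ∏ j, B' r i j := by
    intro r
    refine ((hs (r + 1)).mul_left (C r)).congr fun i => ?_
    rw [← Finset.mul_prod_erase _ _ (Finset.mem_univ l),
      ← Finset.mul_prod_erase Finset.univ (B' r i) (Finset.mem_univ l)]
    have h1 : ∏ j ∈ Finset.univ.erase l, B' r i j = ∏ j ∈ Finset.univ.erase l, B (r + 1) i j :=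
      Finset.prod_congr rfl fun j hj => by
        simp [B', Function.update_of_ne (Finset.ne_of_mem_erase hj)]
    rw [h1]
    simp only [B', Function.update_self]
    ring
  have hsum' : ∀ x : Fin (n + 1) → ℝ, Summable fun i => a i * ∏ j, v' i j (x j) := fun x =>
    Summable.of_norm_bounded ((hs' 0).mul_left _) fun i => norm_term_le (hB' 0 i) x
  refine ⟨fun x => ∑' i, a i * ∏ j, v' i j (x j), ?_, fun x => ?_⟩
  · exact IsSlotSeries.mem_FSpace (d := fun j => decide (j = k)) (M := M + 2) (by omega)
      ⟨a, v', B', hB', hs', fun x : Fin (n + 1) → ℝ => (hsum' x).hasSum⟩ (k := k) (by simp)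
  · refine (hsum x).unique ?_
    refine (((hsum' x).hasSum.mul_left (x l : ℂ)).add
      ((hsum (Function.update x l 0)).mul_left (gaussian (x l)))).congr_fun fun i => Eq.symm ?_
    rw [← Finset.mul_prod_erase _ _ (Finset.mem_univ l),
      ← Finset.mul_prod_erase Finset.univ (fun j => v i j (x j)) (Finset.mem_univ l),
      ← Finset.mul_prod_erase Finset.univ (fun j => v i j (Function.update x l 0 j))
        (Finset.mem_univ l)]
    have h1 : ∏ j ∈ Finset.univ.erase l, v' i j (x j) = ∏ j ∈ Finset.univ.erase l, v i j (x j) :=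
      Finset.prod_congr rfl fun j hj => by
        simp only [v', Function.update_of_ne (Finset.ne_of_mem_erase hj)]
    have h2 : ∏ j ∈ Finset.univ.erase l, v i j (Function.update x l 0 j) =
        ∏ j ∈ Finset.univ.erase l, v i j (x j) :=
      Finset.prod_congr rfl fun j hj => by
        simp only [Function.update_of_ne (Finset.ne_of_mem_erase hj)]
    rw [h1, h2]
    simp only [v', Function.update_self]
    rw [div_spec (hB 0 i l) (x l)]
    ring

/-- The function `e^(-x²)`, which generates the homology in degree `0`. -/
theorem gaussian_mem_FSpace : (fun x : Fin 1 → ℝ => gaussian (x 0)) ∈ FSpace 0 := by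
  choose B hB using exists_slotBound_gaussian
  refine IsSlotSeries.mem_FSpace (d := fun _ => true) two_pos (k := 0)
    ⟨fun i => if i = 0 then 1 else 0, fun _ _ => gaussian, fun r _ _ => B r,
      fun r _ _ => hB r, fun r => ?_, fun x => ?_⟩ rfl
  · refine summable_of_ne_finset_zero (s := {0}) fun i hi => ?_
    simp [Finset.notMem_singleton.1 hi]
  · convert hasSum_ite_eq (0 : ℕ) (gaussian (x 0)) using 2 with i
    simp

/-! ### The differential in terms of sequences -/

/-- A point `(x_0, …, x_n)` extended to a sequence by the value `-x_0`.  With this convention the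
last, twisted, term of `b_ev` has the same form as the others. -/
def twistExt {n : ℕ} (x : Fin (n + 1) → ℝ) (l : ℕ) : ℝ :=
  if h : l < n + 1 then x ⟨l, h⟩ else -x 0

/-- The monotone surjection of `ℕ` which takes the value `j` twice. -/
def dup (j l : ℕ) : ℕ := if l ≤ j then l else l - 1

/-- The monotone injection of `ℕ` which omits the value `i`. -/
def skip (i l : ℕ) : ℕ := if l < i then l else l + 1

theorem twistExt_fin {n : ℕ} (x : Fin (n + 1) → ℝ) (l : Fin (n + 1)) : twistExt x l = x l :=
  dif_pos l.2

theorem twistExt_zero {n : ℕ} (x : Fin (n + 1) → ℝ) : twistExt x 0 = x 0 :=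
  twistExt_fin x 0

theorem continuous_twistExt {n : ℕ} (l : ℕ) :
    Continuous fun x : Fin (n + 1) → ℝ => twistExt x l := by
  unfold twistExt
  split_ifs <;> fun_prop

theorem dup_zero_right (j : ℕ) : dup j 0 = 0 := by simp [dup]

theorem dup_comp_dup {i j : ℕ} (h : i ≤ j) (l : ℕ) : dup i (dup (j + 1) l) = dup j (dup i l) := by
  unfold dup; split_ifs <;> omega

theorem dup_comp_skip_of_le {i j : ℕ} (h : j ≤ i) (l : ℕ) :
    dup j (skip (i + 2) l) = skip (i + 1) (dup j l) := by
  unfold dup skip; split_ifs <;> omega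

theorem dup_comp_skip_of_lt {i j : ℕ} (h : i < j) (l : ℕ) :
    dup (j + 1) (skip (i + 1) l) = skip (i + 1) (dup j l) := by
  unfold dup skip; split_ifs <;> omega

theorem dup_comp_skip_self (i l : ℕ) : dup i (skip (i + 1) l) = l := by
  unfold dup skip; split_ifs <;> omega

theorem dup_succ_comp_skip_self (i l : ℕ) : dup (i + 1) (skip (i + 1) l) = l := by
  unfold dup skip; split_ifs <;> omega

theorem twistExt_dup {n : ℕ} (x : Fin (n + 1) → ℝ) {i l : ℕ} (hi : i ≤ n + 1) (hl : l ≤ n + 2) :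
    twistExt (fun l : Fin (n + 2) => twistExt x (dup i l)) l = twistExt x (dup i l) := by
  rcases hl.lt_or_eq with h | rfl
  · simp [twistExt, h]
  · have h1 : dup i (n + 2) = n + 1 := by unfold dup; split_ifs <;> omega
    rw [h1]
    simp [twistExt, dup_zero_right]

theorem twistExt_skip {n : ℕ} (x : Fin (n + 2) → ℝ) {i l : ℕ} (hi : i ≤ n) (hl : l ≤ n + 1) :
    twistExt (fun l : Fin (n + 1) => twistExt x (skip (i + 1) l)) l =
      twistExt x (skip (i + 1) l) := by
  rcases hl.lt_or_eq with h | rfl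
  · simp [twistExt, h]
  · have h1 : skip (i + 1) (n + 1) = n + 2 := by unfold skip; split_ifs <;> omega
    have h2 : skip (i + 1) 0 = 0 := by simp [skip]
    rw [h1]
    simp [twistExt, h2]

theorem bEv_apply (n : ℕ) (f : (Fin (n + 2) → ℝ) → ℂ) (x : Fin (n + 1) → ℝ) :
    bEv n f x = ∑ j ∈ Finset.range (n + 2),
      (-1 : ℂ) ^ j * f fun l : Fin (n + 2) => twistExt x (dup j l) := by
  rw [Finset.sum_range_succ, Finset.sum_range]
  change (∑ i : Fin (n + 1), (-1 : ℂ) ^ (i : ℕ) * f fun j => x (i.predAbove j)) +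
    (-1 : ℂ) ^ (n + 1) * f (Fin.snoc x (-(x 0))) = _
  congr 1
  · refine Finset.sum_congr rfl fun i _ => ?_
    congr 2
    funext l
    have h : dup (i : ℕ) (l : ℕ) = (i.predAbove l : ℕ) := by
      rw [Fin.predAbove]
      unfold dup
      split_ifs with h1 h2 h2 <;> simp [Fin.lt_def] at h2 ⊢ <;> omega
    rw [h, twistExt_fin]
  · congr 2
    funext l
    have h : dup (n + 1) l = l := by unfold dup; split_ifs <;> omega
    rw [h]
    simp only [Fin.snoc, twistExt]
    split_ifs <;> rfl

/-- The simplicial identities make the alternating double sum of `b_ev ∘ b_ev` cancel in pairs. -/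
theorem sum_dup_dup (F : (ℕ → ℕ) → ℂ) (N : ℕ) :
    ∑ i ∈ Finset.range N, ∑ j ∈ Finset.range (N + 1),
      (-1 : ℂ) ^ i * ((-1) ^ j * F fun l => dup i (dup j l)) = 0 := by
  induction N with
  | zero => simp
  | succ N ih =>
    have h : ∀ i, i ≤ N → (-1 : ℂ) ^ i * ((-1) ^ (N + 1) * F fun l => dup i (dup (N + 1) l)) =
        -((-1) ^ N * ((-1) ^ i * F fun l => dup N (dup i l))) := by
      intro i hi
      simp only [dup_comp_dup hi]
      ring
    simp only [Finset.sum_range_succ _ (N + 1), Finset.sum_add_distrib]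
    rw [Finset.sum_range_succ, ih, zero_add,
      Finset.sum_congr rfl fun i hi => h i (Nat.lt_succ_iff.1 (Finset.mem_range.1 hi)),
      Finset.sum_neg_distrib, add_neg_cancel]

theorem bEv_bEv (n : ℕ) (f : (Fin (n + 3) → ℝ) → ℂ) : bEv n (bEv (n + 1) f) = 0 := by
  funext x
  rw [bEv_apply, Pi.zero_apply,
    ← sum_dup_dup (fun s => f fun l : Fin (n + 3) => twistExt x (s l)) (n + 2)]
  refine Finset.sum_congr rfl fun i hi => ?_
  rw [bEv_apply, Finset.mul_sum]
  refine Finset.sum_congr rfl fun j hj => ?_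
  congr 3
  funext l
  refine twistExt_dup x (Nat.lt_succ_iff.1 (Finset.mem_range.1 hi)) ?_
  unfold dup
  split_ifs <;> omega

theorem bEv_grading (n : ℕ) (f : (Fin (n + 2) → ℝ) → ℂ) :
    bEv n (grading (n + 1) f) = grading n (bEv n f) := by
  funext x
  change _ = bEv n f (-x)
  rw [bEv_apply, bEv_apply]
  refine Finset.sum_congr rfl fun j _ => ?_
  congr 1
  change f _ = f _
  congr 1
  funext l
  simp only [Pi.neg_apply, twistExt]
  split_ifs <;> rfl

/-! ### The complex `𝓕` -/

theorem exists_slotBound_one : ∀ r, ∃ K, SlotBound false 1 r K 1 :=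
  fun r => ⟨_, SlotBound.const one_pos r 1⟩

theorem pullback_mem {n n' : ℕ} {f : (Fin (n + 1) → ℝ) → ℂ} (hf : f ∈ FSpace n)
    (σ : Fin (n + 1) → Fin (n' + 1)) {ε : Fin (n + 1) → ℝ} (hε : ∀ j, ε j = 1 ∨ ε j = -1) :
    (fun y : Fin (n' + 1) → ℝ => f fun j => ε j * y (σ j)) ∈ FSpace n' := by
  have := substMap_mem hf (c := fun _ => 1) (σ := σ) (ε := ε) (e := fun _ => false)
    (fun j => (hε j).imp_right Or.inl) one_pos (fun _ => exists_slotBound_one)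
    (Or.inr fun j => by rcases hε j with h | h <;> simp [h])
  convert this using 2 with y
  simp [substMap]

theorem bEv_mem {n : ℕ} {f : (Fin (n + 2) → ℝ) → ℂ} (hf : f ∈ FSpace (n + 1)) :
    bEv n f ∈ FSpace n := by
  have e : bEv n f = ∑ j ∈ Finset.range (n + 2),
      (-1 : ℂ) ^ j • fun x : Fin (n + 1) → ℝ => f fun l : Fin (n + 2) => twistExt x (dup j l) := by
    funext x
    rw [bEv_apply, Finset.sum_apply]
    rfl
  rw [e]
  refine Submodule.sum_mem _ fun j hj => Submodule.smul_mem _ _ ?_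
  convert pullback_mem hf
    (fun l => if h : dup j l < n + 1 then (⟨dup j l, h⟩ : Fin (n + 1)) else 0)
    (ε := fun l => if dup j l < n + 1 then 1 else -1) (fun l => by split_ifs <;> simp)
    using 3 with x
  funext l
  unfold twistExt
  split_ifs <;> simp

theorem grading_mem {n : ℕ} {f : (Fin (n + 1) → ℝ) → ℂ} (hf : f ∈ FSpace n) :
    grading n f ∈ FSpace n := by
  convert pullback_mem hf id (ε := fun _ => -1) (fun _ => Or.inr rfl) using 1
  funext x
  change f _ = f _
  congr 1
  funext l
  simp

/-! ### The shuffle homotopy -/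

/-- The signed shuffle product with the coordinate function: the coordinate is inserted as a new
variable in all positions `1, …, n + 1`. -/
noncomputable def shuffle (n : ℕ) :
    ((Fin (n + 1) → ℝ) → ℂ) →ₗ[ℂ] ((Fin (n + 2) → ℝ) → ℂ) :=
  ∑ i : Fin (n + 1), (-1 : ℂ) ^ (i : ℕ) •
    substMap (fun k => if k = i.succ then fun y => (y : ℂ) else 1) i.succ.succAbove fun _ => 1

theorem shuffle_mem {n : ℕ} {f : (Fin (n + 1) → ℝ) → ℂ} (hf : f ∈ FSpace n) :
    shuffle n f ∈ FSpace (n + 1) := by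
  rw [shuffle, LinearMap.sum_apply]
  refine Submodule.sum_mem _ fun i _ => Submodule.smul_mem _ _ ?_
  refine substMap_mem hf (e := fun _ => false) (fun _ => Or.inl rfl) one_pos (fun k r => ?_)
    (Or.inr fun _ => one_ne_zero)
  split_ifs
  · exact exists_slotBound_id r
  · exact exists_slotBound_one r

theorem succAbove_val {n : ℕ} (i : Fin (n + 1)) (l : Fin n) : (i.succAbove l : ℕ) = skip i l := by
  rw [Fin.succAbove]
  unfold skip
  split_ifs with h1 h2 h2 <;> simp [Fin.lt_def] at h1 ⊢ <;> omega

theorem shuffle_apply (n : ℕ) (f : (Fin (n + 1) → ℝ) → ℂ) (x : Fin (n + 2) → ℝ) :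
    shuffle n f x = ∑ i ∈ Finset.range (n + 1), (-1 : ℂ) ^ i * ((twistExt x (i + 1) : ℝ) *
      f fun l : Fin (n + 1) => twistExt x (skip (i + 1) l)) := by
  rw [shuffle, LinearMap.sum_apply, Finset.sum_apply, Finset.sum_range]
  refine Finset.sum_congr rfl fun i _ => ?_
  rw [LinearMap.smul_apply, Pi.smul_apply, smul_eq_mul]
  congr 1
  change (∏ k, (if k = i.succ then fun y : ℝ => (y : ℂ) else 1) (x k)) *
    (f fun j => 1 * x (i.succ.succAbove j)) = _
  congr 1
  · rw [Finset.prod_eq_single i.succ (fun k _ hk => by rw [if_neg hk, Pi.one_apply])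
      (fun h => absurd (Finset.mem_univ _) h), if_pos rfl, ← twistExt_fin x i.succ, Fin.val_succ]
  · congr 1
    funext l
    rw [one_mul, ← twistExt_fin x, succAbove_val, Fin.val_succ]

/-- In `b h + h b`, with `h` the shuffle product with the coordinate, all terms cancel except those
in which the inserted coordinate meets one of its two neighbours, and these telescope. -/
theorem sum_shuffle (X : ℕ → ℂ) (F : (ℕ → ℕ) → ℂ) (n : ℕ) :
    ∑ j ∈ Finset.range (n + 2), ∑ i ∈ Finset.range (n + 1), (-1 : ℂ) ^ j *
        ((-1) ^ i * (X (dup j (i + 1)) * F fun l => dup j (skip (i + 1) l))) +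
      ∑ i ∈ Finset.range n, ∑ j ∈ Finset.range (n + 1), (-1 : ℂ) ^ i *
        (X (i + 1) * ((-1) ^ j * F fun l => skip (i + 1) (dup j l))) =
      (X 0 - X (n + 1)) * F fun l => l := by
  have h₁ : ∀ i, (-1 : ℂ) ^ i *
      ((-1) ^ i * (X (dup i (i + 1)) * F fun l => dup i (skip (i + 1) l))) =
        X i * F fun l => l := by
    intro i
    have : dup i (i + 1) = i := by simp [dup]
    simp only [dup_comp_skip_self, this]
    rw [← mul_assoc, ← mul_pow]
    simp
  have h₂ : ∀ i, (-1 : ℂ) ^ (i + 1) *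
      ((-1) ^ i * (X (dup (i + 1) (i + 1)) * F fun l => dup (i + 1) (skip (i + 1) l))) =
        -(X (i + 1) * F fun l => l) := by
    intro i
    have : dup (i + 1) (i + 1) = i + 1 := by simp [dup]
    simp only [dup_succ_comp_skip_self, this]
    have h : (-1 : ℂ) ^ i * (-1) ^ i = 1 := by rw [← mul_pow]; simp
    linear_combination (-(X (i + 1) * F fun l => l)) * h
  induction n with
  | zero =>
    have h₁0 := h₁ 0
    have h₂0 := h₂ 0
    simp only [Finset.sum_range_succ, Finset.sum_range_zero, zero_add] at h₁0 h₂0 ⊢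
    rw [h₁0, h₂0]
    ring
  | succ n ih =>
    have h₃ : ∀ j ∈ Finset.range (n + 1), (-1 : ℂ) ^ j * ((-1) ^ (n + 1) *
        (X (dup j (n + 1 + 1)) * F fun l => dup j (skip (n + 1 + 1) l))) =
        -((-1 : ℂ) ^ n * (X (n + 1) * ((-1) ^ j * F fun l => skip (n + 1) (dup j l)))) := by
      intro j hj
      have hj' := Nat.lt_succ_iff.1 (Finset.mem_range.1 hj)
      have : dup j (n + 1 + 1) = n + 1 := by unfold dup; split_ifs <;> omega
      simp only [dup_comp_skip_of_le hj', this]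
      ring
    have h₄ : ∀ i ∈ Finset.range (n + 1), (-1 : ℂ) ^ (n + 2) * ((-1) ^ i *
        (X (dup (n + 2) (i + 1)) * F fun l => dup (n + 2) (skip (i + 1) l))) =
        -((-1 : ℂ) ^ i * (X (i + 1) *
          ((-1) ^ (n + 1) * F fun l => skip (i + 1) (dup (n + 1) l)))) := by
      intro i hi
      have hi' := Finset.mem_range.1 hi
      have : dup (n + 2) (i + 1) = i + 1 := by unfold dup; split_ifs <;> omega
      simp only [dup_comp_skip_of_lt hi', this]
      ring
    have e₁ := Finset.sum_congr rfl h₃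
    have e₂ := Finset.sum_congr rfl h₄
    have e₃ := h₁ (n + 1)
    have e₄ := h₂ (n + 1)
    rw [Finset.sum_neg_distrib] at e₁ e₂
    rw [Finset.sum_range_succ _ (n + 2)]
    simp only [Finset.sum_range_succ _ (n + 1), Finset.sum_add_distrib] at ih e₁ e₂ e₃ e₄ ⊢
    simp only [Finset.sum_range_succ _ n, Finset.sum_add_distrib] at ih e₁ e₂ e₃ e₄ ⊢
    linear_combination ih + e₁ + e₂ + e₃ + e₄

theorem bEv_shuffle_sum (n : ℕ) (f : (Fin (n + 1) → ℝ) → ℂ) (x : Fin (n + 1) → ℝ) :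
    bEv n (shuffle n f) x = ∑ j ∈ Finset.range (n + 2), ∑ i ∈ Finset.range (n + 1), (-1 : ℂ) ^ j *
      ((-1) ^ i * ((twistExt x (dup j (i + 1)) : ℝ) *
        f fun l : Fin (n + 1) => twistExt x (dup j (skip (i + 1) l)))) := by
  rw [bEv_apply]
  refine Finset.sum_congr rfl fun j hj => ?_
  rw [shuffle_apply, Finset.mul_sum]
  refine Finset.sum_congr rfl fun i hi => ?_
  have hj' := Nat.lt_succ_iff.1 (Finset.mem_range.1 hj)
  have hi' := Finset.mem_range.1 hi
  rw [twistExt_dup x hj' (by omega)]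
  congr 4
  funext l
  refine twistExt_dup x hj' ?_
  unfold skip
  split_ifs <;> omega

theorem bEv_shuffle_zero (f : (Fin 1 → ℝ) → ℂ) (x : Fin 1 → ℝ) :
    bEv 0 (shuffle 0 f) x = 2 * (x 0 : ℂ) * f x := by
  have h := sum_shuffle (fun l => (twistExt x l : ℂ)) (fun s => f fun l => twistExt x (s l)) 0
  have e : f (fun l => twistExt x l) = f x := congrArg f (funext fun l => twistExt_fin x l)
  have e' : twistExt x (0 + 1) = -x 0 := by simp [twistExt]
  rw [e, e', twistExt_zero, Finset.range_zero, Finset.sum_empty, add_zero] at h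
  rw [bEv_shuffle_sum]
  exact h.trans (by push_cast; ring)

/-- Multiplication by `2 x_0` is null-homotopic on the complex. -/
theorem bEv_shuffle (p : ℕ) (f : (Fin (p + 2) → ℝ) → ℂ) (x : Fin (p + 2) → ℝ) :
    bEv (p + 1) (shuffle (p + 1) f) x + shuffle p (bEv p f) x = 2 * (x 0 : ℂ) * f x := by
  have h := sum_shuffle (fun l => (twistExt x l : ℂ)) (fun s => f fun l => twistExt x (s l)) (p + 1)
  have e : f (fun l => twistExt x l) = f x := congrArg f (funext fun l => twistExt_fin x l)
  have e' : twistExt x (p + 1 + 1) = -x 0 := by simp [twistExt]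
  rw [e, e', twistExt_zero] at h
  refine Eq.trans ?_ (h.trans (by push_cast; ring))
  congr 1
  · exact bEv_shuffle_sum _ _ _
  · rw [shuffle_apply]
    refine Finset.sum_congr rfl fun i hi => ?_
    rw [bEv_apply, Finset.mul_sum, Finset.mul_sum]
    refine Finset.sum_congr rfl fun j hj => ?_
    congr 4
    funext l
    refine twistExt_skip x (Nat.lt_succ_iff.1 (Finset.mem_range.1 hi)) ?_
    unfold dup
    split_ifs <;> omega

/-! ### The fibre over `x_0 = 0` -/

/-- The operator `f ↦ e^(-x_0²) u(x_1) f(0, x_2, …, x_(n+1))`. -/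
noncomputable def fibreInsert (n : ℕ) (u : ℝ → ℂ) :
    ((Fin (n + 1) → ℝ) → ℂ) →ₗ[ℂ] ((Fin (n + 2) → ℝ) → ℂ) :=
  substMap (fun k => if k = 0 then gaussian else if k = 1 then u else 1) (Fin.succAbove 1)
    fun j => if j = 0 then 0 else 1

theorem fibreInsert_mem {n : ℕ} {f : (Fin (n + 1) → ℝ) → ℂ} (hf : f ∈ FSpace n) {u : ℝ → ℂ}
    (hu : ∀ r, ∃ K, SlotBound false 1 r K u) : fibreInsert n u f ∈ FSpace (n + 1) := by
  refine substMap_mem hf (e := fun k => decide (k = 0)) (M' := 2)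
    (fun j => by split_ifs <;> simp) two_pos (fun k r => ?_) (Or.inl ⟨0, by simp⟩)
  split_ifs with h₀ h₁
  · rw [decide_eq_true h₀]
    exact exists_slotBound_gaussian r
  · rw [decide_eq_false h₀]
    obtain ⟨K, hK⟩ := hu r
    exact ⟨K, hK.mono_order one_pos one_le_two⟩
  · rw [decide_eq_false h₀]
    obtain ⟨K, hK⟩ := exists_slotBound_one r
    exact ⟨K, hK.mono_order one_pos one_le_two⟩

theorem fibreInsert_apply (n : ℕ) (u : ℝ → ℂ) (f : (Fin (n + 1) → ℝ) → ℂ) {y : Fin (n + 2) → ℝ}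
    (hy : y 0 = 0) : fibreInsert n u f y = u (y 1) * f fun l => twistExt y (skip 1 l) := by
  change (∏ k, (if k = 0 then gaussian else if k = 1 then u else 1) (y k)) *
    (f fun j => (if j = 0 then 0 else 1) * y (Fin.succAbove 1 j)) = _
  congr 1
  · rw [Fin.prod_univ_succ, Fin.prod_univ_succ]
    simp [hy, gaussian_zero, Fin.ext_iff]
  · congr 1
    funext l
    have h : (skip 1 l : ℕ) = (Fin.succAbove (1 : Fin (n + 2)) l : ℕ) := by
      rw [succAbove_val, Fin.val_one]
    rw [h, twistExt_fin]
    split_ifs with hl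
    · subst hl
      simp [hy]
    · rw [one_mul]

/-- On the fibre over `x_0 = 0` the operators `fibreInsert` are homotopies which compare the values
of the function `u` at `0` and at `x_1`. -/
theorem bEv_fibreInsert (p : ℕ) (u : ℝ → ℂ) (f : (Fin (p + 2) → ℝ) → ℂ) {x : Fin (p + 2) → ℝ}
    (hx : x 0 = 0) {y : Fin (p + 1) → ℝ} (hy : y = fun l : Fin (p + 1) => twistExt x (skip 1 l)) :
    bEv (p + 1) (fibreInsert (p + 1) u f) x =
      u 0 * f x - u (x 1) * (f x + (bEv p f y - f fun l => twistExt y (dup 0 l))) := by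
  have hterm : ∀ j ∈ Finset.range (p + 3), (-1 : ℂ) ^ j *
      fibreInsert (p + 1) u f (fun l : Fin (p + 3) => twistExt x (dup j l)) =
      (-1 : ℂ) ^ j * (u (twistExt x (dup j 1)) *
        f fun l : Fin (p + 2) => twistExt x (dup j (skip 1 l))) := by
    intro j hj
    have hj' := Nat.lt_succ_iff.1 (Finset.mem_range.1 hj)
    rw [fibreInsert_apply]
    · congr 4
      funext l
      refine twistExt_dup x hj' ?_
      unfold skip
      split_ifs <;> omega
    · simp [dup_zero_right, twistExt_zero, hx]
  rw [bEv_apply, Finset.sum_congr rfl hterm, bEv_apply, Finset.sum_range_succ' _ (p + 2),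
    Finset.sum_range_succ' _ (p + 1), Finset.sum_range_succ' _ (p + 1)]
  have h₀ : (fun l : Fin (p + 2) => twistExt x (dup 0 (skip 1 l))) = x := by
    funext l
    rw [dup_comp_skip_self 0, twistExt_fin]
  have h₁ : (fun l : Fin (p + 2) => twistExt x (dup (0 + 1) (skip 1 l))) = x := by
    funext l
    rw [dup_succ_comp_skip_self 0, twistExt_fin]
  have hd₀ : twistExt x (dup 0 1) = 0 := by simp [dup, twistExt_zero, hx]
  have hx1 : twistExt x 1 = x 1 := twistExt_fin x 1
  have hd₁ : ∀ j, twistExt x (dup (j + 1) 1) = x 1 := fun j => by simp [dup, hx1]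
  have h₂ : ∀ j ∈ Finset.range (p + 1), (-1 : ℂ) ^ (j + 1 + 1) *
      (u (twistExt x (dup (j + 1 + 1) 1)) *
        f fun l : Fin (p + 2) => twistExt x (dup (j + 1 + 1) (skip 1 l))) =
      -u (x 1) * ((-1) ^ (j + 1) * f fun l : Fin (p + 2) => twistExt y (dup (j + 1) l)) := by
    intro j _
    have e : (fun l : Fin (p + 2) => twistExt x (dup (j + 1 + 1) (skip 1 l))) =
        fun l : Fin (p + 2) => twistExt y (dup (j + 1) l) := by
      funext l
      rw [hy, dup_comp_skip_of_lt (Nat.succ_pos j)]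
      refine (twistExt_skip x (Nat.zero_le p) ?_).symm
      unfold dup
      split_ifs <;> omega
    rw [hd₁, e]
    ring
  rw [Finset.sum_congr rfl h₂, ← Finset.mul_sum, h₀, h₁, hd₀, hd₁]
  ring

/-- The point `(0, 0, x_2, …)` as a degeneracy. -/
theorem twistExt_dup_zero {p : ℕ} {x : Fin (p + 2) → ℝ} (hx : x 0 = 0) {y : Fin (p + 1) → ℝ}
    (hy : y = fun l : Fin (p + 1) => twistExt x (skip 1 l)) :
    (fun l : Fin (p + 2) => twistExt y (dup 0 l)) = Function.update x 1 0 := by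
  have hy0 : y 0 = 0 := by
    rw [hy]
    change twistExt x (skip 1 0) = 0
    simp [skip, twistExt_zero, hx]
  funext l
  induction l using Fin.cases with
  | zero => simp [dup_zero_right, twistExt_zero, hx, hy0]
  | succ l =>
    have h : dup 0 (l.succ : ℕ) = l := by simp [dup]
    rw [h, twistExt_fin]
    induction l using Fin.cases with
    | zero => simp [hy0]
    | succ l =>
      have h1 : l.succ.succ ≠ 1 := by simp [Fin.ext_iff]
      rw [Function.update_of_ne h1, hy, ← twistExt_fin x]
      simp [skip]

/-! ### Vanishing of the homology in positive degrees -/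

theorem eq_zero_of_mul_eq_zero {h : ℝ → ℂ} (hc : Continuous h) (h0 : ∀ t : ℝ, (t : ℂ) * h t = 0)
    (t : ℝ) : h t = 0 := by
  have : h = fun _ => 0 := by
    refine Continuous.ext_on (dense_compl_singleton (0 : ℝ)) hc continuous_const fun s hs => ?_
    exact (mul_eq_zero.1 (h0 s)).resolve_left (Complex.ofReal_ne_zero.2 hs)
  exact congrFun this t

/-- A continuous function which vanishes after multiplication by a coordinate is zero. -/
theorem eq_zero_of_coord_mul {N : ℕ} {h : (Fin N → ℝ) → ℂ} (hc : Continuous h) (l : Fin N)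
    (x : Fin N → ℝ) (h0 : ∀ t : ℝ, (t : ℂ) * h (Function.update x l t) = 0) : h x = 0 := by
  have := eq_zero_of_mul_eq_zero (h := fun t => h (Function.update x l t))
    (hc.comp (continuous_const.update l continuous_id)) h0 (x l)
  simpa using this

/-- A cycle which vanishes on the hyperplane `x_0 = 0` is a boundary. -/
theorem exists_bEv_eq_of_vanishing {p : ℕ} {f : (Fin (p + 2) → ℝ) → ℂ} (hf : f ∈ FSpace (p + 1))
    (hb : bEv p f = 0) (h0 : ∀ x, x 0 = 0 → f x = 0) : ∃ g ∈ FSpace (p + 2), bEv (p + 1) g = f := by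
  obtain ⟨k, hk, hfk⟩ := exists_div_coord hf 0
  have hfk' : ∀ x, f x = (x 0 : ℂ) * k x := fun x => by
    rw [hfk x, h0 (Function.update x 0 0) (by simp), mul_zero, add_zero]
  have hmul : ∀ x, (x 0 : ℂ) * bEv p k x = 0 := fun x => by
    have h := congrFun hb x
    rw [Pi.zero_apply, bEv_apply] at h
    rw [← h, bEv_apply, Finset.mul_sum]
    refine Finset.sum_congr rfl fun j _ => ?_
    rw [hfk', mul_left_comm]
    simp [dup_zero_right, twistExt_zero]
  have hbk : bEv p k = 0 := by
    funext x
    refine eq_zero_of_coord_mul (continuous_of_mem_FSpace (bEv_mem hk)) 0 x fun t => ?_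
    simpa using hmul (Function.update x 0 t)
  refine ⟨(1 / 2 : ℂ) • shuffle (p + 1) k, Submodule.smul_mem _ _ (shuffle_mem hk), ?_⟩
  funext x
  have h := bEv_shuffle p k x
  rw [hbk, map_zero, Pi.zero_apply, add_zero] at h
  rw [map_smul, Pi.smul_apply, h, hfk', smul_eq_mul]
  ring

/-- The obstruction to extending the contraction of the fibre over `x_0 = 0` vanishes for a cycle
`f` whose restriction to this fibre is `x_1 g`. -/
theorem bEv_sub_degenerate_eq_zero {p : ℕ} {f g : (Fin (p + 2) → ℝ) → ℂ}
    (hf : f ∈ FSpace (p + 1)) (hg : g ∈ FSpace (p + 1)) (hb : bEv p f = 0)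
    (hfg : ∀ x, x 0 = 0 → f x = (x 1 : ℂ) * g x) {y : Fin (p + 1) → ℝ} (hy : y 0 = 0) :
    bEv p g y - g (fun l => twistExt y (dup 0 l)) = 0 := by
  cases p with
  | succ p =>
    have hc : Continuous fun y : Fin (p + 2) → ℝ =>
        bEv (p + 1) g y - g (fun l => twistExt y (dup 0 l)) :=
      (continuous_of_mem_FSpace (bEv_mem hg)).sub ((continuous_of_mem_FSpace hg).comp
        (continuous_pi fun l => continuous_twistExt _))
    refine eq_zero_of_coord_mul hc 1 y fun t => ?_
    set z := Function.update y 1 t with hz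
    have hz0 : z 0 = 0 := by rw [hz, Function.update_of_ne (by simp), hy]
    have hz1 : z 1 = t := by rw [hz, Function.update_self]
    have h := congrFun hb z
    have hfz : ∀ j, f (fun l : Fin (p + 3) => twistExt z (dup j l)) =
        (twistExt z (dup j 1) : ℝ) * g fun l : Fin (p + 3) => twistExt z (dup j l) := fun j =>
      hfg _ (by simp [dup_zero_right, twistExt_zero, hz0])
    have hd₀ : twistExt z (dup 0 1) = 0 := by simp [dup, twistExt_zero, hz0]
    have hd₁ : ∀ j, twistExt z (dup (j + 1) 1) = t := fun j => by
      have : twistExt z 1 = z 1 := twistExt_fin z 1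
      simp [dup, this, hz1]
    rw [Pi.zero_apply, bEv_apply, Finset.sum_range_succ'] at h
    simp only [hfz, hd₀, hd₁] at h
    rw [bEv_apply, Finset.sum_range_succ', ← h, mul_sub, mul_add, Finset.mul_sum]
    push_cast
    simp only [pow_zero, one_mul, zero_mul, add_zero, add_sub_cancel_right]
    exact Finset.sum_congr rfl fun j _ => by ring
  | zero =>
    -- In degree `1` the cycle condition is `f(t, t) = f(t, -t)`; divide it by `t`.
    obtain ⟨k, hk, hfk⟩ := exists_div_coord hf 0
    have hf' : ∀ s t : ℝ, f ![s, t] = (s : ℂ) * k ![s, t] + gaussian s * ((t : ℂ) * g ![0, t]) := by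
      intro s t
      have e : Function.update ![s, t] 0 0 = ![0, t] := by
        funext l
        fin_cases l <;> simp
      rw [hfk, e, hfg _ (by simp)]
      simp
    have hb' : ∀ h : (Fin 2 → ℝ) → ℂ, ∀ z : Fin 1 → ℝ,
        bEv 0 h z = h ![z 0, z 0] - h ![z 0, -z 0] := by
      intro h z
      rw [bEv_apply, Finset.sum_range_succ, Finset.sum_range_one, pow_zero, pow_one, one_mul,
        neg_one_mul, ← sub_eq_add_neg]
      congr 2 <;> funext l <;> fin_cases l <;> simp [twistExt, dup]
    have hgc := continuous_of_mem_FSpace hg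
    have hkc := continuous_of_mem_FSpace hk
    have hc : Continuous fun t : ℝ => k ![t, t] + gaussian t * g ![0, t] - k ![t, -t] +
        gaussian t * g ![0, -t] := by
      have := contDiff_gaussian.continuous
      fun_prop
    have h := eq_zero_of_mul_eq_zero hc (fun t => by
      have h := congrFun hb fun _ => t
      rw [hb', hf', hf', Pi.zero_apply] at h
      push_cast at h
      linear_combination h) 0
    have hg0 : g ![0, 0] = 0 := by
      simp only [gaussian_zero, neg_zero] at h
      linear_combination h / 2
    have e : (fun l : Fin 2 => twistExt y (dup 0 l)) = ![0, 0] := by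
      funext l
      fin_cases l <;> simp [twistExt, dup, hy]
    rw [hb', e, hy, neg_zero, hg0]
    simp

/-- Every cycle of positive degree is a boundary: two corrections by `fibreInsert` make it vanish
on the hyperplane `x_0 = 0`. -/
theorem exists_bEv_eq {p : ℕ} {f : (Fin (p + 2) → ℝ) → ℂ} (hf : f ∈ FSpace (p + 1))
    (hb : bEv p f = 0) : ∃ g ∈ FSpace (p + 2), bEv (p + 1) g = f := by
  set G₁ := fibreInsert (p + 1) 1 f
  have hG₁ : G₁ ∈ FSpace (p + 2) := fibreInsert_mem hf exists_slotBound_one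
  set f₁ := f - bEv (p + 1) G₁
  have hf₁ : f₁ ∈ FSpace (p + 1) := sub_mem hf (bEv_mem hG₁)
  have hb₁ : bEv p f₁ = 0 := by rw [map_sub, hb, bEv_bEv, sub_zero]
  have hval₁ : ∀ x, x 0 = 0 → f₁ x = f x - f (Function.update x 1 0) := by
    intro x hx
    simp only [f₁, G₁, Pi.sub_apply]
    rw [bEv_fibreInsert p 1 f hx rfl, twistExt_dup_zero hx rfl, hb]
    simp
  obtain ⟨g, hg, hfg⟩ := exists_div_coord hf₁ 1
  have hfg₁ : ∀ x, x 0 = 0 → f₁ x = (x 1 : ℂ) * g x := by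
    intro x hx
    have h : Function.update x 1 0 0 = 0 := by rw [Function.update_of_ne (by simp), hx]
    rw [hfg x, hval₁ _ h]
    simp
  set G₂ := fibreInsert (p + 1) (fun t => (t : ℂ)) g
  have hG₂ : G₂ ∈ FSpace (p + 2) := fibreInsert_mem hg exists_slotBound_id
  have hval₂ : ∀ x, x 0 = 0 → (f₁ + bEv (p + 1) G₂) x = 0 := by
    intro x hx
    simp only [G₂, Pi.add_apply]
    rw [bEv_fibreInsert p _ g hx rfl, bEv_sub_degenerate_eq_zero hf₁ hg hb₁ hfg₁, hfg₁ x hx]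
    · simp
    · change twistExt x (skip 1 0) = 0
      simp [skip, twistExt_zero, hx]
  obtain ⟨G₃, hG₃, h₃⟩ := exists_bEv_eq_of_vanishing (add_mem hf₁ (bEv_mem hG₂))
    (by rw [map_add, hb₁, bEv_bEv, add_zero]) hval₂
  refine ⟨G₃ - G₂ + G₁, add_mem (sub_mem hG₃ hG₂) hG₁, ?_⟩
  rw [map_add, map_sub, h₃]
  simp [f₁]

/-! ### The homology in degree `0` -/

theorem exists_bEv_eq_sub_gaussian {f : (Fin 1 → ℝ) → ℂ} (hf : f ∈ FSpace 0) :
    ∃ g ∈ FSpace 1, bEv 0 g = f - f 0 • fun x => gaussian (x 0) := by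
  obtain ⟨k, hk, hfk⟩ := exists_div_coord hf 0
  refine ⟨(1 / 2 : ℂ) • shuffle 0 k, Submodule.smul_mem _ _ (shuffle_mem hk), ?_⟩
  funext x
  have e : Function.update x 0 0 = 0 := by
    funext l
    rw [Fin.fin_one_eq_zero l, Function.update_self, Pi.zero_apply]
  rw [map_smul, Pi.smul_apply, bEv_shuffle_zero, Pi.sub_apply, hfk x, e]
  simp only [smul_eq_mul, Pi.smul_apply]
  ring

theorem bEv_zero_apply_zero (g : (Fin 2 → ℝ) → ℂ) : bEv 0 g 0 = 0 := by
  have h : ∀ j, (fun l : Fin 2 => twistExt (0 : Fin 1 → ℝ) (dup j l)) = 0 := fun j => by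
    funext l
    simp [twistExt]
  rw [bEv_apply]
  simp [h, Finset.sum_range_succ]

/-- The cycle `e^(-x²)` of degree `0`. -/
noncomputable def gaussianCycle : cycles 0 := ⟨fun x => gaussian (x 0), gaussian_mem_FSpace⟩

theorem homologyClass_eq_smul (w : cycles 0) :
    homologyClass 0 w = (w : (Fin 1 → ℝ) → ℂ) 0 • homologyClass 0 gaussianCycle := by
  rw [← map_smul]
  refine (Submodule.Quotient.eq _).2 ?_
  obtain ⟨g, hg, h⟩ := exists_bEv_eq_sub_gaussian w.2
  exact ⟨g, hg, h⟩

theorem homologyClass_gaussianCycle_ne_zero : homologyClass 0 gaussianCycle ≠ 0 := by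
  intro h
  obtain ⟨g, -, hg⟩ := (Submodule.Quotient.mk_eq_zero _).1 h
  have h1 := congrFun hg 0
  rw [bEv_zero_apply_zero] at h1
  have h2 : (gaussianCycle : (Fin 1 → ℝ) → ℂ) 0 = 1 := gaussian_zero
  exact zero_ne_one (h1.trans h2)

end EvenHochschild

theorem mainTheorem4 :
    -- `(𝓕^(n), b_ev)` is a complex, with a compatible action of the grading
    (∀ n : ℕ, ∀ f ∈ EvenHochschild.FSpace (n + 1),
      EvenHochschild.bEv n f ∈ EvenHochschild.FSpace n) ∧
    (∀ n : ℕ, ∀ f ∈ EvenHochschild.FSpace (n + 2),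
      EvenHochschild.bEv n (EvenHochschild.bEv (n + 1) f) = 0) ∧
    (∀ n : ℕ, ∀ f ∈ EvenHochschild.FSpace n,
      EvenHochschild.grading n f ∈ EvenHochschild.FSpace n) ∧
    (∀ n : ℕ, ∀ f ∈ EvenHochschild.FSpace (n + 1),
      EvenHochschild.bEv n (EvenHochschild.grading (n + 1) f) =
        EvenHochschild.grading n (EvenHochschild.bEv n f)) ∧
    -- the homology is concentrated in degree `0` and one-dimensional
    (∀ n : ℕ, 0 < n → Subsingleton (EvenHochschild.Homology n)) ∧
    Module.finrank ℂ (EvenHochschild.Homology 0) = 1 ∧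
    -- the generator is even
    (∃ c : EvenHochschild.cycles 0,
      EvenHochschild.grading 0 (c : (Fin 1 → ℝ) → ℂ) = c ∧
      Submodule.span ℂ {EvenHochschild.homologyClass 0 c} = ⊤) := by
  have hgen : ∀ w : EvenHochschild.Homology 0,
      ∃ a : ℂ, a • EvenHochschild.homologyClass 0 EvenHochschild.gaussianCycle = w := fun w => by
    obtain ⟨z, rfl⟩ := Submodule.mkQ_surjective _ w
    exact ⟨_, (EvenHochschild.homologyClass_eq_smul z).symm⟩
  refine ⟨fun n f hf => EvenHochschild.bEv_mem hf, fun n f _ => EvenHochschild.bEv_bEv n f,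
    fun n f hf => EvenHochschild.grading_mem hf, fun n f _ => EvenHochschild.bEv_grading n f,
    fun n hn => ?_, ?_, EvenHochschild.gaussianCycle, ?_, ?_⟩
  · obtain ⟨p, rfl⟩ := Nat.exists_eq_succ_of_ne_zero hn.ne'
    rw [Submodule.Quotient.subsingleton_iff, eq_top_iff]
    rintro ⟨f, hf, hb⟩ -
    obtain ⟨g, hg, h⟩ := EvenHochschild.exists_bEv_eq hf hb
    exact ⟨g, hg, h⟩
  · exact finrank_eq_one _ EvenHochschild.homologyClass_gaussianCycle_ne_zero hgen
  · funext x
    exact EvenHochschild.gaussian_neg (x 0)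
  · rw [Submodule.span_singleton_eq_top_iff]
    exact hgen
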